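/- Let $I$ be a nonempty finite set. A forest on $I$ is a set of leaf-labelled rooted (non-planar) binary trees whose leaves are, all together, bijectively labelled by $I$; $V(F)$ denotes its set of inner vertices. An inner-oriented forest $o\otimes F$ is a forest $F$ with a global orientation $o$ (a generator of the top exterior power of $\mathbb{Z}(V(F)\sqcup\{R\})$, $R$ an auxiliary element) and, at each inner vertex, a local orientation (a generator of the top exterior power on its three half-edges). Let $\operatorname{Bess}(I)$ be the $\mathbb{Q}$-vector space spanned by inner-oriented forests on $I$, where reversing a global or a local orientation changes the sign. It is graded by the number of inner vertices. For disjoint nonempty finite sets $I,J$, composition with the two generators of the Bessel operad gives bilinear maps $E,\Omega:\operatorname{Bess}(I)\times\operatorname{Bess}(J)\to\operatorname{Bess}(I\sqcup J)$: if $o_1=R_1\wedge v_1\wedge\dots\wedge v_m$ and $o_2=R_2\wedge w_1\wedge\dots\wedge w_n$, then $$E(o_1\otimes F_1,o_2\otimes F_2)=(R\wedge v_1\wedge\dots\wedge v_m\wedge w_1\wedge\dots\wedge w_n)\otimes(F_1\sqcup F_2),$$ $$\Omega(o_1\otimes F_1,o_2\otimes F_2)=\sum_{T_1,T_2}(R\wedge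 v\wedge v_1\wedge\dots\wedge v_m\wedge w_1\wedge\dots\wedge w_n)\otimes F_{T_1,T_2},$$ where $T_1$ (resp. $T_2$) runs over the trees of $F_1$ (resp. $F_2$), the forest $F_{T_1,T_2}$ is obtained from $F_1\sqcup F_2$ by joining the roots of $T_1$ and $T_2$ to a new inner vertex $v$, with local orientation $\mathrm{root}\wedge T_1\wedge T_2$ at $v$, and the other local orientations are unchanged. There is exactly one family of linear maps $\Delta:\operatorname{Bess}(I)\to\operatorname{Bess}(I)\otimes\operatorname{Bess}(I)$ (the coproduct of the Bessel operad) such that $\Delta(u)=u\otimes u$ for the one-leaf tree $u$ with orientation $R$, and, for all $x,y$, $$\Delta(E(x,y))=(E\otimes E)(\Delta x,\Delta y),\qquad \Delta(\Omega(x,y))=(E\otimes\Omega+\Omega\otimes E)(\Delta x,\Delta y),$$ where, by the Koszul sign rule, $(\mu\otimes\nu)(x_1\otimes x_2,y_1\otimes y_2)=(-1)^{|\nu|(|x_1|+|y_1|)+|x_2||y_1|}\mu(x_1,y_1)\otimes\nu(x_2,y_2)$, with $|E|=0$ and $|\Omega|=1$. For each nonempty finite set $I$ the following holds. The degree zero component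 of $\operatorname{Bess}(I)$ is one-dimensional, spanned by the forest $g_I$ with no inner vertex (with orientation $R$). Identify this component with $\mathbb{Q}$ by $g_I\mapsto 1$; let $\varepsilon:\operatorname{Bess}(I)\to\mathbb{Q}$ be the projection onto it and $\eta:\mathbb{Q}\to\operatorname{Bess}(I)$ its inclusion. Then $\varepsilon$ is a counit, that is $(\varepsilon\otimes\mathrm{id})\Delta=\mathrm{id}=(\mathrm{id}\otimes\varepsilon)\Delta$; the map $\eta$ is an augmentation, that is $\Delta(\eta(1))=\eta(1)\otimes\eta(1)$ and $\varepsilon\circ\eta=\mathrm{id}$; and $g_I$ is grouplike, that is $\Delta(g_I)=g_I\otimes g_I$ and $\varepsilon(g_I)=1$. -/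

import Mathlib

open scoped TensorProduct

namespace Bessel

/-! ### Forests of leaf-labelled rooted binary trees

A forest with set of leaves `S` is recorded by the set of its inner vertices. An inner vertex is
recorded by the unordered pair `s(A, B)`, where `A` and `B` are the sets of leaves lying above its
two incoming edges. A tree or a subtree is thus identified by its set of leaves. -/

section Forests

variable {α : Type*} [DecidableEq α]

/-- `IsTree S V`: the set `V` is the set of inner vertices of a rooted binary tree whose leaves are
bijectively labelled by `S`. -/
inductive IsTree : Finset α → Finset (Sym2 (Finset α)) → Prop
  | leaf (a : α) : IsTree {a} ∅
  | graft {S T : Finset α} {V W : Finset (Sym2 (Finset α))} :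
      IsTree S V → IsTree T W → Disjoint S T → IsTree (S ∪ T) (insert s(S, T) (V ∪ W))

/-- `IsForest S V`: the set `V` is the set of inner vertices of a (nonempty) set of rooted binary
trees whose leaves are, all together, bijectively labelled by `S`. -/
inductive IsForest : Finset α → Finset (Sym2 (Finset α)) → Prop
  | tree {S : Finset α} {V : Finset (Sym2 (Finset α))} : IsTree S V → IsForest S V
  | union {S T : Finset α} {V W : Finset (Sym2 (Finset α))} :
      IsForest S V → IsForest T W → Disjoint S T → IsForest (S ∪ T) (V ∪ W)

/-- The set of leaves lying above an inner vertex. -/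
def vertexLeaves : Sym2 (Finset α) → Finset α :=
  Sym2.lift ⟨fun A B => A ∪ B, fun A B => Finset.union_comm A B⟩

/-- The trees of the forest on `S` with set of inner vertices `V`, each given by its set of leaves:
the leaves and inner vertices which are not directly above another inner vertex. -/
def roots (S : Finset α) (V : Finset (Sym2 (Finset α))) : Finset (Finset α) :=
  (S.image (fun a => {a}) ∪ V.image vertexLeaves).filter (fun r => ∀ v ∈ V, r ∉ v)

@[simp] theorem vertexLeaves_mk (A B : Finset α) : vertexLeaves s(A, B) = A ∪ B := rfl

theorem IsTree.nonempty {S : Finset α} {V : Finset (Sym2 (Finset α))} (h : IsTree S V) :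
    S.Nonempty := by
  induction h with
  | leaf a => simp
  | graft _ _ _ h₁ _ => exact h₁.mono Finset.subset_union_left

theorem IsForest.nonempty {S : Finset α} {V : Finset (Sym2 (Finset α))} (h : IsForest S V) :
    S.Nonempty := by
  induction h with
  | tree h => exact h.nonempty
  | union _ _ _ h₁ _ => exact h₁.mono Finset.subset_union_left

theorem IsTree.vertex {S : Finset α} {V : Finset (Sym2 (Finset α))} (h : IsTree S V) :
    ∀ v ∈ V, vertexLeaves v ⊆ S ∧ ∀ r ∈ v, r.Nonempty ∧ r ⊂ vertexLeaves v := by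
  induction h with
  | leaf a => simp
  | @graft S T V W hV hW hd h₁ h₂ =>
    intro v hv
    simp only [Finset.mem_insert, Finset.mem_union] at hv
    rcases hv with rfl | hv | hv
    · refine ⟨by simp, ?_⟩
      intro r hr
      rcases Sym2.mem_iff.1 hr with rfl | rfl
      · refine ⟨hV.nonempty, ?_⟩
        obtain ⟨x, hx⟩ := hW.nonempty
        exact Finset.ssubset_iff_subset_ne.2 ⟨Finset.subset_union_left, fun h =>
          Finset.disjoint_right.1 hd hx (h ▸ Finset.mem_union_right _ hx)⟩
      · refine ⟨hW.nonempty, ?_⟩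
        obtain ⟨x, hx⟩ := hV.nonempty
        exact Finset.ssubset_iff_subset_ne.2 ⟨Finset.subset_union_right, fun h =>
          Finset.disjoint_left.1 hd hx (h ▸ Finset.mem_union_left _ hx)⟩
    · exact ⟨(h₁ v hv).1.trans Finset.subset_union_left, (h₁ v hv).2⟩
    · exact ⟨(h₂ v hv).1.trans Finset.subset_union_right, (h₂ v hv).2⟩

theorem IsForest.vertex {S : Finset α} {V : Finset (Sym2 (Finset α))} (h : IsForest S V) :
    ∀ v ∈ V, vertexLeaves v ⊆ S ∧ ∀ r ∈ v, r.Nonempty ∧ r ⊂ vertexLeaves v := by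
  induction h with
  | tree h => exact h.vertex
  | @union S T V W hV hW hd h₁ h₂ =>
    intro v hv
    rcases Finset.mem_union.1 hv with hv | hv
    · exact ⟨(h₁ v hv).1.trans Finset.subset_union_left, (h₁ v hv).2⟩
    · exact ⟨(h₂ v hv).1.trans Finset.subset_union_right, (h₂ v hv).2⟩

theorem IsForest.vertexLeaves_nonempty {S : Finset α} {V : Finset (Sym2 (Finset α))}
    (h : IsForest S V) {v : Sym2 (Finset α)} (hv : v ∈ V) : (vertexLeaves v).Nonempty := by
  induction v with
  | _ A B => exact ((h.vertex _ hv).2 A (Sym2.mem_mk_left _ _)).1.mono Finset.subset_union_left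

theorem IsForest.of_mem_roots {S : Finset α} {V : Finset (Sym2 (Finset α))} (h : IsForest S V)
    {r : Finset α} (hr : r ∈ roots S V) : r.Nonempty ∧ r ⊆ S := by
  simp only [roots, Finset.mem_filter, Finset.mem_union, Finset.mem_image] at hr
  obtain ⟨⟨a, ha, rfl⟩ | ⟨v, hv, rfl⟩, -⟩ := hr
  · simpa using ha
  · exact ⟨h.vertexLeaves_nonempty hv, (h.vertex v hv).1⟩

theorem IsTree.eq_of_mem_roots {S : Finset α} {V : Finset (Sym2 (Finset α))} (h : IsTree S V)
    {r : Finset α} (hr : r ∈ roots S V) : r = S := by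
  induction h generalizing r with
  | leaf a => simpa [roots] using hr
  | @graft S T V W hV hW hd h₁ h₂ =>
    simp only [roots, Finset.mem_filter, Finset.mem_union, Finset.mem_image,
      Finset.mem_insert] at hr
    obtain ⟨hr, hn⟩ := hr
    have hS : r ≠ S := fun e => hn _ (Or.inl rfl) (e ▸ Sym2.mem_mk_left _ _)
    have hT : r ≠ T := fun e => hn _ (Or.inl rfl) (e ▸ Sym2.mem_mk_right _ _)
    have key₁ : r ∈ S.image (fun a => {a}) ∪ V.image vertexLeaves → False := fun h =>
      hS (h₁ (Finset.mem_filter.2 ⟨h, fun v hv => hn v (Or.inr (Or.inl hv))⟩))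
    have key₂ : r ∈ T.image (fun a => {a}) ∪ W.image vertexLeaves → False := fun h =>
      hT (h₂ (Finset.mem_filter.2 ⟨h, fun v hv => hn v (Or.inr (Or.inr hv))⟩))
    simp only [Finset.mem_union, Finset.mem_image] at key₁ key₂
    rcases hr with ⟨a, ha | ha, e⟩ | ⟨v, rfl | hv | hv, e⟩
    · exact (key₁ (Or.inl ⟨a, ha, e⟩)).elim
    · exact (key₂ (Or.inl ⟨a, ha, e⟩)).elim
    · exact e.symm
    · exact (key₁ (Or.inr ⟨v, hv, e⟩)).elim
    · exact (key₂ (Or.inr ⟨v, hv, e⟩)).elim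

/-- A tree can be removed from a forest. -/
theorem IsForest.split {S : Finset α} {V : Finset (Sym2 (Finset α))} (h : IsForest S V)
    {r : Finset α} (hr : r ∈ roots S V) :
    (r = S ∧ IsTree S V) ∨ ∃ S' V₁ V₂, Disjoint r S' ∧ S = r ∪ S' ∧ V = V₁ ∪ V₂ ∧
      IsTree r V₁ ∧ IsForest S' V₂ := by
  induction h generalizing r with
  | tree h => exact Or.inl ⟨h.eq_of_mem_roots hr, h⟩
  | @union S T V W hV hW hd h₁ h₂ =>
    right
    simp only [roots, Finset.mem_filter, Finset.mem_union, Finset.mem_image] at hr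
    obtain ⟨hr, hn⟩ := hr
    have hr' : r ∈ roots S V ∨ r ∈ roots T W := by
      simp only [roots, Finset.mem_filter, Finset.mem_union, Finset.mem_image]
      rcases hr with ⟨a, ha | ha, e⟩ | ⟨v, hv | hv, e⟩
      · exact Or.inl ⟨Or.inl ⟨a, ha, e⟩, fun v hv => hn v (Or.inl hv)⟩
      · exact Or.inr ⟨Or.inl ⟨a, ha, e⟩, fun v hv => hn v (Or.inr hv)⟩
      · exact Or.inl ⟨Or.inr ⟨v, hv, e⟩, fun v hv => hn v (Or.inl hv)⟩
      · exact Or.inr ⟨Or.inr ⟨v, hv, e⟩, fun v hv => hn v (Or.inr hv)⟩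
    rcases hr' with hr' | hr'
    · rcases h₁ hr' with ⟨rfl, ht⟩ | ⟨S', V₁, V₂, hd', rfl, rfl, ht, hf⟩
      · exact ⟨T, V, W, hd, rfl, rfl, ht, hW⟩
      · rw [Finset.disjoint_union_left] at hd
        exact ⟨S' ∪ T, V₁, V₂ ∪ W, Finset.disjoint_union_right.2 ⟨hd', hd.1⟩,
          Finset.union_assoc _ _ _, Finset.union_assoc _ _ _, ht, hf.union hW hd.2⟩
    · rcases h₂ hr' with ⟨rfl, ht⟩ | ⟨T', W₁, W₂, hd', rfl, rfl, ht, hf⟩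
      · exact ⟨S, W, V, hd.symm, Finset.union_comm _ _, Finset.union_comm _ _, ht, hV⟩
      · rw [Finset.disjoint_union_right] at hd
        exact ⟨S ∪ T', W₁, V ∪ W₂, Finset.disjoint_union_right.2 ⟨hd.1.symm, hd'⟩,
          Finset.union_left_comm _ _ _, Finset.union_left_comm _ _ _, ht, hV.union hf hd.2⟩

/-- Joining a tree of a first forest and a tree of a second forest by a new inner vertex gives a
forest. -/
theorem IsForest.graft {S T : Finset α} {V W : Finset (Sym2 (Finset α))} (hV : IsForest S V)
    (hW : IsForest T W) (hd : Disjoint S T) {r s : Finset α} (hr : r ∈ roots S V)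
    (hs : s ∈ roots T W) : IsForest (S ∪ T) (insert s(r, s) (V ∪ W)) := by
  rcases hV.split hr with ⟨rfl, ht⟩ | ⟨S', V₁, V₂, hS, rfl, rfl, ht, hf⟩ <;>
    rcases hW.split hs with ⟨rfl, ht'⟩ | ⟨T', W₁, W₂, hT, rfl, rfl, ht', hf'⟩
  · exact .tree (.graft ht ht' hd)
  · simp only [Finset.disjoint_union_right] at hd
    have := (IsForest.tree (.graft ht ht' hd.1)).union hf'
      (Finset.disjoint_union_left.2 ⟨hd.2, hT⟩)
    convert this using 1 <;> ext <;> simp only [Finset.mem_union, Finset.mem_insert] <;> tauto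
  · simp only [Finset.disjoint_union_left] at hd
    have := (IsForest.tree (.graft ht ht' hd.1)).union hf
      (Finset.disjoint_union_left.2 ⟨hS, hd.2.symm⟩)
    convert this using 1 <;> ext <;> simp only [Finset.mem_union, Finset.mem_insert] <;> tauto
  · have h₁ := Finset.disjoint_union_left.1 hd
    have h₂ := Finset.disjoint_union_right.1 h₁.1
    have h₃ := Finset.disjoint_union_right.1 h₁.2
    have := (IsForest.tree (.graft ht ht' h₂.1)).union (hf.union hf' h₃.2)
      (Finset.disjoint_union_left.2 ⟨Finset.disjoint_union_right.2 ⟨hS, h₂.2⟩,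
        Finset.disjoint_union_right.2 ⟨h₃.1.symm, hT⟩⟩)
    convert this using 1 <;> ext <;> simp only [Finset.mem_union, Finset.mem_insert] <;> tauto

theorem IsForest.noVertex {S : Finset α} (hS : S.Nonempty) : IsForest S ∅ := by
  induction hS using Finset.Nonempty.cons_induction with
  | singleton a => exact .tree (.leaf a)
  | cons a s ha hs ih =>
    have := (IsForest.tree (.leaf a)).union ih (Finset.disjoint_singleton_left.2 ha)
    rw [Finset.cons_eq_insert, Finset.insert_eq]
    rwa [Finset.union_empty] at this

end Forests

/-! ### Inner-oriented forests

A global orientation of a forest `F` is an orientation of `V(F) ⊔ {R}`; up to sign it is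
`R ∧ v₁ ∧ ⋯ ∧ vₙ` for an ordering of the inner vertices. A local orientation at an inner vertex
is an orientation of its three half-edges; up to sign it is `root ∧ A ∧ B` for an ordering of the
two incoming half-edges. -/

/-- A forest on `S` with an ordering `v₁, …, vₙ` of its inner vertices and, at each inner vertex,
an ordering `(A, B)` of the two incoming half-edges. It represents the inner-oriented forest with
global orientation `R ∧ v₁ ∧ ⋯ ∧ vₙ` and local orientations `root ∧ A ∧ B`. -/
@[ext] structure OrientedForest {α : Type*} [DecidableEq α] (S : Finset α) where
  vertices : List (Finset α × Finset α)
  nodup : (vertices.map (fun v => s(v.1, v.2))).Nodup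
  isForest : IsForest S (vertices.map (fun v => s(v.1, v.2))).toFinset

section Oriented

variable {α : Type*} [DecidableEq α]

namespace OrientedForest

variable {S T : Finset α}

/-- The set of (unoriented) inner vertices. -/
def vertexSet (F : OrientedForest S) : Finset (Sym2 (Finset α)) :=
  (F.vertices.map (fun v => s(v.1, v.2))).toFinset

/-- The trees of the forest, each given by its set of leaves. -/
def trees (F : OrientedForest S) : Finset (Finset α) := roots S F.vertexSet

/-- Two elementary ways of reversing the orientation: exchanging two consecutive inner vertices in
the global orientation, or exchanging the two incoming half-edges in one local orientation. -/
inductive Opposite (F G : OrientedForest S) : Prop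
  | swap (l₁ l₂ : List (Finset α × Finset α)) (v w : Finset α × Finset α)
      (hF : F.vertices = l₁ ++ v :: w :: l₂) (hG : G.vertices = l₁ ++ w :: v :: l₂) : Opposite F G
  | flip (l₁ l₂ : List (Finset α × Finset α)) (A B : Finset α)
      (hF : F.vertices = l₁ ++ (A, B) :: l₂) (hG : G.vertices = l₁ ++ (B, A) :: l₂) : Opposite F G

theorem disjoint_vertexSet (h : Disjoint S T) (F : OrientedForest S) (G : OrientedForest T) :
    Disjoint F.vertexSet G.vertexSet := by
  rw [Finset.disjoint_left]
  intro v hF hG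
  obtain ⟨x, hx⟩ := F.isForest.vertexLeaves_nonempty hF
  exact Finset.disjoint_left.1 h ((F.isForest.vertex v hF).1 hx) ((G.isForest.vertex v hG).1 hx)

/-- The disjoint union `(o₁ ⊔ o₂) ⊗ (F ⊔ G)`; the global orientation is obtained from
`o₁ ∧ r ∧ o₂` by replacing `R₁ ∧ r ∧ R₂` by `R`, so that
`R₁ ∧ v₁ ∧ ⋯ ∧ vₘ` and `R₂ ∧ w₁ ∧ ⋯ ∧ wₙ` give `R ∧ v₁ ∧ ⋯ ∧ vₘ ∧ w₁ ∧ ⋯ ∧ wₙ`. -/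
def disjointUnion (h : Disjoint S T) (F : OrientedForest S) (G : OrientedForest T) :
    OrientedForest (S ∪ T) where
  vertices := F.vertices ++ G.vertices
  nodup := by
    rw [List.map_append, List.nodup_append']
    refine ⟨F.nodup, G.nodup, ?_⟩
    intro v hv hw
    exact Finset.disjoint_left.1 (disjoint_vertexSet h F G) (List.mem_toFinset.2 hv)
      (List.mem_toFinset.2 hw)
  isForest := by
    rw [List.map_append, List.toFinset_append]
    exact F.isForest.union G.isForest h

/-- The forest obtained from `F ⊔ G` by joining the tree `r` of `F` and the tree `s` of `G` by a
new inner vertex `v`. The global orientation is `(-1)^{o₁} o₁ ∧ o₂` with `R₁ ∧ R₂` replaced by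
`R ∧ v`, so that `R₁ ∧ v₁ ∧ ⋯ ∧ vₘ` and `R₂ ∧ w₁ ∧ ⋯ ∧ wₙ` give
`R ∧ v ∧ v₁ ∧ ⋯ ∧ vₘ ∧ w₁ ∧ ⋯ ∧ wₙ`. The local orientation at `v` is `root ∧ r ∧ s`. -/
def graft (h : Disjoint S T) (F : OrientedForest S) (G : OrientedForest T) {r s : Finset α}
    (hr : r ∈ F.trees) (hs : s ∈ G.trees) : OrientedForest (S ∪ T) where
  vertices := (r, s) :: (F.vertices ++ G.vertices)
  nodup := by
    rw [List.map_cons, List.nodup_cons]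
    refine ⟨?_, (disjointUnion h F G).nodup⟩
    intro hm
    obtain ⟨⟨x, hx⟩, hrS⟩ := F.isForest.of_mem_roots hr
    obtain ⟨⟨y, hy⟩, hsT⟩ := G.isForest.of_mem_roots hs
    rw [List.map_append, List.mem_append] at hm
    rcases hm with hm | hm
    · have h₁ := (F.isForest.vertex _ (List.mem_toFinset.2 hm)).1
      exact Finset.disjoint_left.1 h (h₁ (Finset.mem_union_right _ hy)) (hsT hy)
    · have h₁ := (G.isForest.vertex _ (List.mem_toFinset.2 hm)).1
      exact Finset.disjoint_left.1 h (hrS hx) (h₁ (Finset.mem_union_left _ hx))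
  isForest := by
    rw [List.map_cons, List.toFinset_cons, List.map_append, List.toFinset_append]
    exact F.isForest.graft G.isForest h hr hs

/-- The forest with no inner vertex. -/
def noVertex (hS : S.Nonempty) : OrientedForest S where
  vertices := []
  nodup := List.nodup_nil
  isForest := IsForest.noVertex hS

theorem Opposite.length_eq {F G : OrientedForest S} (h : Opposite F G) :
    F.vertices.length = G.vertices.length := by
  cases h with
  | swap l₁ l₂ v w hF hG => simp [hF, hG]
  | flip l₁ l₂ A B hF hG => simp [hF, hG]

theorem Opposite.vertexSet_eq {F G : OrientedForest S} (h : Opposite F G) :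
    F.vertexSet = G.vertexSet := by
  cases h with
  | swap l₁ l₂ v w hF hG =>
    ext x
    simp only [vertexSet, hF, hG, List.map_append, List.map_cons, List.mem_toFinset,
      List.mem_append, List.mem_cons]
    tauto
  | flip l₁ l₂ A B hF hG => simp [vertexSet, hF, hG, Sym2.eq_swap (a := A)]

theorem Opposite.trees_eq {F G : OrientedForest S} (h : Opposite F G) : F.trees = G.trees := by
  rw [trees, trees, h.vertexSet_eq]

end OrientedForest

/-- The relations `F = -G` for opposite inner-oriented forests. -/
noncomputable def orientationRel (S : Finset α) : Submodule ℚ (OrientedForest S →₀ ℚ) :=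
  Submodule.span ℚ
    {x | ∃ F G : OrientedForest S, F.Opposite G ∧ x = Finsupp.single F 1 + Finsupp.single G 1}

/-- The vector space `Bess(S)` spanned by inner-oriented forests on `S`. -/
abbrev Bess (S : Finset α) : Type _ := (OrientedForest S →₀ ℚ) ⧸ orientationRel S

/-- The element of `Bess(S)` given by an inner-oriented forest. -/
noncomputable def cls {S : Finset α} (F : OrientedForest S) : Bess S :=
  (orientationRel S).mkQ (Finsupp.single F 1)

theorem cls_add_cls {S : Finset α} {F G : OrientedForest S} (h : F.Opposite G) :
    cls F + cls G = 0 := by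
  rw [cls, cls, ← map_add, Submodule.mkQ_apply, Submodule.Quotient.mk_eq_zero]
  exact Submodule.subset_span ⟨F, G, h, rfl⟩

/-- A function on inner-oriented forests changing sign under a change of orientation extends to a
linear map on `Bess(S)`. -/
noncomputable def liftBess {S : Finset α} {M : Type*} [AddCommGroup M] [Module ℚ M]
    (f : OrientedForest S → M) (hf : ∀ F G, F.Opposite G → f F + f G = 0) : Bess S →ₗ[ℚ] M :=
  (orientationRel S).liftQ (Finsupp.linearCombination ℚ f) <| by
    rw [orientationRel, Submodule.span_le]
    rintro _ ⟨F, G, h, rfl⟩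
    simpa using hf F G h

@[simp] theorem liftBess_cls {S : Finset α} {M : Type*} [AddCommGroup M] [Module ℚ M]
    (f : OrientedForest S → M) (hf : ∀ F G, F.Opposite G → f F + f G = 0)
    (F : OrientedForest S) : liftBess f hf (cls F) = f F := by
  simp [liftBess, cls, Submodule.liftQ_apply]

theorem hom_ext {S : Finset α} {M : Type*} [AddCommGroup M] [Module ℚ M]
    {f g : Bess S →ₗ[ℚ] M} (h : ∀ F, f (cls F) = g (cls F)) : f = g := by
  apply Submodule.linearMap_qext
  apply Finsupp.lhom_ext'
  intro F
  apply LinearMap.ext_ring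
  exact h F

/-- The component of `Bess(S)` of degree `n`; the degree is the number of inner vertices. -/
noncomputable def component (S : Finset α) (n : ℕ) : Submodule ℚ (Bess S) :=
  Submodule.span ℚ {x | ∃ F : OrientedForest S, F.vertices.length = n ∧ x = cls F}

/-- The projection of `Bess(S)` onto its component of degree `n`. -/
noncomputable def proj (S : Finset α) (n : ℕ) : Bess S →ₗ[ℚ] component S n :=
  liftBess
    (fun F => if h : F.vertices.length = n then ⟨cls F, Submodule.subset_span ⟨F, h, rfl⟩⟩ else 0)
    (by
      intro F G h
      by_cases hF : F.vertices.length = n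
      · have hG : G.vertices.length = n := h.length_eq ▸ hF
        rw [dif_pos hF, dif_pos hG]
        exact Subtype.ext (cls_add_cls h)
      · have hG : ¬ G.vertices.length = n := h.length_eq ▸ hF
        rw [dif_neg hF, dif_neg hG, add_zero])

/-- The endomorphism of `Bess(S)` projecting onto the component of degree `n`. -/
noncomputable def projEnd (S : Finset α) (n : ℕ) : Bess S →ₗ[ℚ] Bess S :=
  (component S n).subtype ∘ₗ proj S n

/-- The endomorphism of `Bess(S)` acting by `(-1)^n` in degree `n`. -/
noncomputable def parity (S : Finset α) : Bess S →ₗ[ℚ] Bess S :=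
  ∑ n ∈ Finset.range (S.card + 1), (-1 : ℚ) ^ n • projEnd S n

/-! ### The composition with the generators `E` and `Ω` of the operad -/

section Generators

variable {S T : Finset α}

theorem cls_disjointUnion_left (h : Disjoint S T) {F F' : OrientedForest S} (hF : F.Opposite F')
    (G : OrientedForest T) : cls (F.disjointUnion h G) + cls (F'.disjointUnion h G) = 0 := by
  apply cls_add_cls
  cases hF with
  | swap l₁ l₂ v w h₁ h₂ =>
    exact .swap l₁ (l₂ ++ G.vertices) v w (by simp [OrientedForest.disjointUnion, h₁])
      (by simp [OrientedForest.disjointUnion, h₂])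
  | flip l₁ l₂ A B h₁ h₂ =>
    exact .flip l₁ (l₂ ++ G.vertices) A B (by simp [OrientedForest.disjointUnion, h₁])
      (by simp [OrientedForest.disjointUnion, h₂])

theorem cls_disjointUnion_right (h : Disjoint S T) (F : OrientedForest S)
    {G G' : OrientedForest T} (hG : G.Opposite G') :
    cls (F.disjointUnion h G) + cls (F.disjointUnion h G') = 0 := by
  apply cls_add_cls
  cases hG with
  | swap l₁ l₂ v w h₁ h₂ =>
    exact .swap (F.vertices ++ l₁) l₂ v w (by simp [OrientedForest.disjointUnion, h₁])
      (by simp [OrientedForest.disjointUnion, h₂])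
  | flip l₁ l₂ A B h₁ h₂ =>
    exact .flip (F.vertices ++ l₁) l₂ A B (by simp [OrientedForest.disjointUnion, h₁])
      (by simp [OrientedForest.disjointUnion, h₂])

/-- The operation `(x, y) ↦ E_{⋆,#} ∘_⋆ x ∘_# y`, given on inner-oriented forests by
`(o₁ ⊔ o₂) ⊗ (F ⊔ G)`. -/
noncomputable def compE (h : Disjoint S T) : Bess S →ₗ[ℚ] Bess T →ₗ[ℚ] Bess (S ∪ T) :=
  liftBess
    (fun F => liftBess (fun G => cls (F.disjointUnion h G))
      (fun _ _ hG => cls_disjointUnion_right h F hG))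
    (by
      intro F F' hF
      apply hom_ext
      intro G
      simpa using cls_disjointUnion_left h hF G)

/-- The sum `(o₁ ∨ o₂) ⊗ (F ∨ G)` over all pairs of a tree of `F` and a tree of `G`, where these
two trees are joined by a new inner vertex. -/
noncomputable def graftSum (h : Disjoint S T) (F : OrientedForest S) (G : OrientedForest T) :
    Bess (S ∪ T) :=
  ∑ r ∈ F.trees.attach, ∑ s ∈ G.trees.attach, cls (F.graft h G r.2 s.2)

theorem cls_graft_left (h : Disjoint S T) {F F' : OrientedForest S} (hF : F.Opposite F')
    (G : OrientedForest T) {r s : Finset α} (hr : r ∈ F.trees) (hr' : r ∈ F'.trees)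
    (hs : s ∈ G.trees) : cls (F.graft h G hr hs) + cls (F'.graft h G hr' hs) = 0 := by
  apply cls_add_cls
  cases hF with
  | swap l₁ l₂ v w h₁ h₂ =>
    exact .swap ((r, s) :: l₁) (l₂ ++ G.vertices) v w (by simp [OrientedForest.graft, h₁])
      (by simp [OrientedForest.graft, h₂])
  | flip l₁ l₂ A B h₁ h₂ =>
    exact .flip ((r, s) :: l₁) (l₂ ++ G.vertices) A B (by simp [OrientedForest.graft, h₁])
      (by simp [OrientedForest.graft, h₂])

theorem cls_graft_right (h : Disjoint S T) (F : OrientedForest S) {G G' : OrientedForest T}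
    (hG : G.Opposite G') {r s : Finset α} (hr : r ∈ F.trees) (hs : s ∈ G.trees)
    (hs' : s ∈ G'.trees) : cls (F.graft h G hr hs) + cls (F.graft h G' hr hs') = 0 := by
  apply cls_add_cls
  cases hG with
  | swap l₁ l₂ v w h₁ h₂ =>
    exact .swap ((r, s) :: (F.vertices ++ l₁)) l₂ v w (by simp [OrientedForest.graft, h₁])
      (by simp [OrientedForest.graft, h₂])
  | flip l₁ l₂ A B h₁ h₂ =>
    exact .flip ((r, s) :: (F.vertices ++ l₁)) l₂ A B (by simp [OrientedForest.graft, h₁])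
      (by simp [OrientedForest.graft, h₂])

theorem sum_attach_congr {β M : Type*} [AddCommMonoid M] {s t : Finset β} (h : s = t)
    (f : ∀ b ∈ s, M) :
    ∑ b ∈ s.attach, f b.1 b.2 = ∑ b ∈ t.attach, f b.1 (h ▸ b.2) := by
  subst h
  rfl

theorem graftSum_left (h : Disjoint S T) {F F' : OrientedForest S} (hF : F.Opposite F')
    (G : OrientedForest T) : graftSum h F G + graftSum h F' G = 0 := by
  rw [graftSum, graftSum, sum_attach_congr hF.trees_eq
    (fun r hr => ∑ s ∈ G.trees.attach, cls (F.graft h G hr s.2)), ← Finset.sum_add_distrib]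
  refine Finset.sum_eq_zero fun r _ => ?_
  rw [← Finset.sum_add_distrib]
  exact Finset.sum_eq_zero fun s _ => cls_graft_left h hF G _ _ _

theorem graftSum_right (h : Disjoint S T) (F : OrientedForest S) {G G' : OrientedForest T}
    (hG : G.Opposite G') : graftSum h F G + graftSum h F G' = 0 := by
  rw [graftSum, graftSum, ← Finset.sum_add_distrib]
  refine Finset.sum_eq_zero fun r _ => ?_
  rw [sum_attach_congr hG.trees_eq (fun s hs => cls (F.graft h G r.2 hs)),
    ← Finset.sum_add_distrib]
  exact Finset.sum_eq_zero fun s _ => cls_graft_right h F hG _ _ _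

/-- The operation `(x, y) ↦ Ω_{⋆,#} ∘_⋆ x ∘_# y`, given on inner-oriented forests by
`(o₁ ∨ o₂) ⊗ (F ∨ G)`. -/
noncomputable def compOmega (h : Disjoint S T) : Bess S →ₗ[ℚ] Bess T →ₗ[ℚ] Bess (S ∪ T) :=
  liftBess
    (fun F => liftBess (fun G => graftSum h F G) (fun _ _ hG => graftSum_right h F hG))
    (by
      intro F F' hF
      apply hom_ext
      intro G
      simpa using graftSum_left h hF G)

/-! ### The composition in the tensor square, with the Koszul sign rule -/

/-- The map `(x₁ ⊗ x₂) ⊗ (y₁ ⊗ y₂) ↦ (-1)^{|x₂||y₁|} (x₁ ⊗ y₁) ⊗ (x₂ ⊗ y₂)`. -/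
noncomputable def koszul (S T : Finset α) :
    (Bess S ⊗[ℚ] Bess S) ⊗[ℚ] (Bess T ⊗[ℚ] Bess T) →ₗ[ℚ]
      (Bess S ⊗[ℚ] Bess T) ⊗[ℚ] (Bess S ⊗[ℚ] Bess T) :=
  ∑ p ∈ Finset.range (S.card + 1), ∑ q ∈ Finset.range (T.card + 1), (-1 : ℚ) ^ (p * q) •
    ((TensorProduct.tensorTensorTensorComm ℚ (Bess S) (Bess S) (Bess T) (Bess T)).toLinearMap ∘ₗ
      TensorProduct.map (TensorProduct.map LinearMap.id (projEnd S p))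
        (TensorProduct.map (projEnd T q) LinearMap.id))

/-- For `X = x₁ ⊗ x₂` and `Y = y₁ ⊗ y₂`, the element `(μ ⊗ ν)_{⋆,#} ∘_⋆ X ∘_# Y` when `ν` has
degree `0`, that is `(-1)^{|x₂||y₁|} μ(x₁, y₁) ⊗ ν(x₂, y₂)`. -/
noncomputable def compTensor (μ ν : Bess S →ₗ[ℚ] Bess T →ₗ[ℚ] Bess (S ∪ T))
    (X : Bess S ⊗[ℚ] Bess S) (Y : Bess T ⊗[ℚ] Bess T) : Bess (S ∪ T) ⊗[ℚ] Bess (S ∪ T) :=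
  TensorProduct.map (TensorProduct.lift μ) (TensorProduct.lift ν) (koszul S T (X ⊗ₜ[ℚ] Y))

/-- The same element `(μ ⊗ ν)_{⋆,#} ∘_⋆ X ∘_# Y` when `ν` has degree `1`, that is
`(-1)^{|x₁| + |y₁| + |x₂||y₁|} μ(x₁, y₁) ⊗ ν(x₂, y₂)`: the operation `ν` passes `x₁` and `y₁`. -/
noncomputable def compTensorOdd (μ ν : Bess S →ₗ[ℚ] Bess T →ₗ[ℚ] Bess (S ∪ T))
    (X : Bess S ⊗[ℚ] Bess S) (Y : Bess T ⊗[ℚ] Bess T) : Bess (S ∪ T) ⊗[ℚ] Bess (S ∪ T) :=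
  compTensor μ ν (TensorProduct.map (parity S) LinearMap.id X)
    (TensorProduct.map (parity T) LinearMap.id Y)

end Generators

/-- The family `Δ` is the morphism of operads from `Bess` to `Bess ⊗ Bess` given on generators by
`Δ(E) = E ⊗ E` and `Δ(Ω) = E ⊗ Ω + Ω ⊗ E`: it maps the unit to the unit and commutes with the
composition with the generators. -/
structure IsCoproduct (Δ : ∀ S : Finset α, Bess S →ₗ[ℚ] Bess S ⊗[ℚ] Bess S) : Prop where
  unit : ∀ a : α,
    Δ {a} (cls (.noVertex (Finset.singleton_nonempty a))) =
      cls (.noVertex (Finset.singleton_nonempty a)) ⊗ₜ[ℚ]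
        cls (.noVertex (Finset.singleton_nonempty a))
  compE : ∀ (S T : Finset α) (h : Disjoint S T) (x : Bess S) (y : Bess T),
    Δ (S ∪ T) (compE h x y) = compTensor (compE h) (compE h) (Δ S x) (Δ T y)
  compOmega : ∀ (S T : Finset α) (h : Disjoint S T) (x : Bess S) (y : Bess T),
    Δ (S ∪ T) (compOmega h x y) =
      compTensorOdd (Bessel.compE h) (Bessel.compOmega h) (Δ S x) (Δ T y) +
        compTensor (Bessel.compOmega h) (Bessel.compE h) (Δ S x) (Δ T y)

/-- The element of degree zero given by the forest with no inner vertex (with orientation `R`). -/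
noncomputable def unitForest (S : Finset α) (hS : S.Nonempty) : component S 0 :=
  ⟨cls (.noVertex hS), Submodule.subset_span ⟨.noVertex hS, rfl, rfl⟩⟩

end Oriented

end Bessel

/-!
The coproduct has an explicit formula: the coproduct of an inner-oriented forest `F` is the signed
sum over all ways to distribute the inner vertices of `F` over the two tensor factors. A vertex
joining the trees `A` and `B` of `F` may land in a factor in which only parts of `A` and `B` are
connected; since `Ω` sums over all pairs of trees, it must then join every tree inside `A` with
every tree inside `B`. Encoding a vertex by the pair of the leaf sets of its two branches, this
amounts to replacing `(A, B)` by all pairs `(a, b)` with `a ⊆ A` and `b ⊆ B`, where a list of pairs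
which does not make up a forest counts as zero.

As every forest is obtained from the one-leaf trees by `E` and `Ω`, up to orientation, the
uniqueness of the coproduct and the counit laws need only be checked on these generators. The counit
kills `Ω` and is multiplicative for `E`, so it turns `Δ(E) = E ⊗ E` and `Δ(Ω) = E ⊗ Ω + Ω ⊗ E` into
the compatibility of the identity with `E` and `Ω`.
-/

namespace Bessel

theorem sum_sum_powerset_eq_sum {α M : Type*} [AddCommMonoid M]
    {P Q : Finset (Finset α)} (hP : (P : Set (Finset α)).PairwiseDisjoint id)
    (hQ : ∀ a ∈ Q, a.Nonempty ∧ ∃ r ∈ P, a ⊆ r) {f : Finset α → M}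
    (hf : ∀ r ∈ P, ∀ a ⊆ r, a ∉ Q → f a = 0) :
    ∑ r ∈ P, ∑ a ∈ r.powerset, f a = ∑ a ∈ Q, f a := by
  classical
  have sum_powerset : ∀ r ∈ P, ∑ a ∈ r.powerset, f a = ∑ a ∈ Q with a ⊆ r, f a := by
    intro r hr
    refine (Finset.sum_subset (fun a ha => ?_) fun a ha ha' => ?_).symm
    · exact Finset.mem_powerset.2 (Finset.mem_filter.1 ha).2
    · have har := Finset.mem_powerset.1 ha
      exact hf r hr a har fun haQ => ha' (Finset.mem_filter.2 ⟨haQ, har⟩)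
  simp only [Finset.sum_congr rfl sum_powerset, Finset.sum_filter]
  rw [Finset.sum_comm]
  refine Finset.sum_congr rfl fun a ha => ?_
  obtain ⟨⟨x, hx⟩, r, hr, har⟩ := hQ a ha
  rw [Finset.sum_eq_single_of_mem r hr, if_pos har]
  exact fun s hs hsr => if_neg fun has =>
    Finset.disjoint_left.1 (hP hs hr hsr) (has hx) (har hx)

section Combinatorics

variable {α : Type*} [DecidableEq α] {S T : Finset α} {V W : Finset (Sym2 (Finset α))}

theorem subset_vertexLeaves {r : Finset α} {v : Sym2 (Finset α)} (h : r ∈ v) :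
    r ⊆ vertexLeaves v := by
  induction v with
  | _ A B =>
    rcases Sym2.mem_iff.1 h with rfl | rfl
    · exact Finset.subset_union_left
    · exact Finset.subset_union_right

theorem mem_roots {r : Finset α} : r ∈ roots S V ↔
    ((∃ a ∈ S, {a} = r) ∨ ∃ v ∈ V, vertexLeaves v = r) ∧ ∀ v ∈ V, r ∉ v := by
  simp [roots]

theorem IsForest.notMem_of_disjoint (h : IsForest S V) {r : Finset α} (hr : Disjoint S r) :
    ∀ v ∈ V, r ∉ v := by
  intro v hv hrv
  obtain ⟨hvS, hv'⟩ := h.vertex v hv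
  obtain ⟨⟨x, hx⟩, hrv'⟩ := hv' r hrv
  exact Finset.disjoint_left.1 hr (hvS (hrv'.1 hx)) hx

theorem roots_union (hV : IsForest S V) (hW : IsForest T W) (hd : Disjoint S T) :
    roots (S ∪ T) (V ∪ W) = roots S V ∪ roots T W := by
  have hSW : ∀ r ∈ roots S V, ∀ v ∈ W, r ∉ v := fun r hr =>
    hW.notMem_of_disjoint (hd.symm.mono_right (hV.of_mem_roots hr).2)
  have hTV : ∀ r ∈ roots T W, ∀ v ∈ V, r ∉ v := fun r hr =>
    hV.notMem_of_disjoint (hd.mono_right (hW.of_mem_roots hr).2)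
  ext r
  simp only [Finset.mem_union, mem_roots] at hSW hTV ⊢
  grind

theorem IsTree.roots_eq (h : IsTree S V) : roots S V = {S} := by
  refine Finset.eq_singleton_iff_unique_mem.2 ⟨mem_roots.2 ⟨?_, fun v hv hS => ?_⟩,
    fun r => h.eq_of_mem_roots⟩
  · cases h with
    | leaf a => exact Or.inl ⟨a, Finset.mem_singleton_self a, rfl⟩
    | graft _ _ _ => exact Or.inr ⟨_, Finset.mem_insert_self _ _, rfl⟩
  · obtain ⟨hvS, hv'⟩ := h.vertex v hv
    exact (hv' S hS).2.not_subset hvS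

theorem IsForest.pairwiseDisjoint_roots (h : IsForest S V) :
    (roots S V : Set (Finset α)).PairwiseDisjoint id := by
  induction h with
  | tree h => simp [h.roots_eq]
  | @union S T V W hV hW hd h₁ h₂ =>
    rw [roots_union hV hW hd, Finset.coe_union]
    exact Set.pairwiseDisjoint_union.2 ⟨h₁, h₂, fun r hr s hs _ =>
      hd.mono (hV.of_mem_roots hr).2 (hW.of_mem_roots hs).2⟩

theorem IsForest.exists_mem_roots_of_mem (h : IsForest S V) {a : α} (ha : a ∈ S) :
    ∃ r ∈ roots S V, a ∈ r := by
  induction h with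
  | tree h => simpa [h.roots_eq] using ha
  | union hV hW hd h₁ h₂ =>
    rw [roots_union hV hW hd]
    rcases Finset.mem_union.1 ha with ha | ha
    · exact (h₁ ha).imp fun r hr => ⟨Finset.mem_union_left _ hr.1, hr.2⟩
    · exact (h₂ ha).imp fun r hr => ⟨Finset.mem_union_right _ hr.1, hr.2⟩

theorem IsForest.exists_mem_roots_of_vertex (h : IsForest S V) {v : Sym2 (Finset α)}
    (hv : v ∈ V) : ∃ r ∈ roots S V, vertexLeaves v ⊆ r := by
  induction h with
  | tree h => simpa [h.roots_eq] using (h.vertex v hv).1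
  | union hV hW hd h₁ h₂ =>
    rw [roots_union hV hW hd]
    rcases Finset.mem_union.1 hv with hv | hv
    · exact (h₁ hv).imp fun r hr => ⟨Finset.mem_union_left _ hr.1, hr.2⟩
    · exact (h₂ hv).imp fun r hr => ⟨Finset.mem_union_right _ hr.1, hr.2⟩

theorem IsTree.card_lt (h : IsTree S V) : V.card < S.card := by
  induction h with
  | leaf a => simp
  | @graft S T V W _ _ hd _ _ =>
    rw [Finset.card_union_of_disjoint hd]
    have := Finset.card_insert_le s(S, T) (V ∪ W)
    have := Finset.card_union_le V W
    omega

theorem IsForest.card_lt (h : IsForest S V) : V.card < S.card := by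
  induction h with
  | tree h => exact h.card_lt
  | @union S T V W _ _ hd _ _ =>
    rw [Finset.card_union_of_disjoint hd]
    have := Finset.card_union_le V W
    omega

theorem IsTree.subset_or_disjoint {X : Finset α} (h : IsTree X V)
    (hV : ∀ v ∈ V, vertexLeaves v ⊆ S ∨ Disjoint (vertexLeaves v) S) :
    X ⊆ S ∨ Disjoint X S := by
  cases h with
  | leaf a => simpa using em (a ∈ S)
  | graft _ _ _ => exact hV _ (Finset.mem_insert_self _ _)

theorem IsForest.restrict {X : Finset α} (h : IsForest X V) (hXS : (X ∩ S).Nonempty)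
    (hV : ∀ v ∈ V, vertexLeaves v ⊆ S ∨ Disjoint (vertexLeaves v) S) :
    IsForest (X ∩ S) (V.filter (vertexLeaves · ⊆ S)) := by
  have filter_eq_empty {Y : Finset α} {W : Finset (Sym2 (Finset α))} (hW : IsForest Y W)
      (hY : Y ∩ S = ∅) : W.filter (vertexLeaves · ⊆ S) = ∅ :=
    Finset.filter_false_of_mem fun v hv hvS => (hW.vertexLeaves_nonempty hv).ne_empty <|
      Finset.subset_empty.1 (hY ▸ Finset.subset_inter (hW.vertex v hv).1 hvS)
  induction h with
  | @tree X V h =>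
    have hX : X ⊆ S := (h.subset_or_disjoint hV).resolve_right fun hd =>
      hXS.ne_empty (Finset.disjoint_iff_inter_eq_empty.1 hd)
    rw [Finset.inter_eq_left.2 hX,
      Finset.filter_true_of_mem fun v hv => (h.vertex v hv).1.trans hX]
    exact .tree h
  | @union X Y V W hX hY hd h₁ h₂ =>
    have hV₁ := fun v hv => hV v (Finset.mem_union_left W hv)
    have hV₂ := fun v hv => hV v (Finset.mem_union_right V hv)
    rw [Finset.union_inter_distrib_right] at hXS ⊢
    rw [Finset.filter_union]
    rcases (X ∩ S).eq_empty_or_nonempty with hXe | hXn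
    · rw [hXe, Finset.empty_union] at hXS ⊢
      rw [filter_eq_empty hX hXe, Finset.empty_union]
      exact h₂ hXS hV₂
    · rcases (Y ∩ S).eq_empty_or_nonempty with hYe | hYn
      · rw [hYe, filter_eq_empty hY hYe, Finset.union_empty, Finset.union_empty]
        exact h₁ hXn hV₁
      · exact (h₁ hXn hV₁).union (h₂ hYn hV₂)
          (hd.mono Finset.inter_subset_left Finset.inter_subset_left)

theorem IsForest.of_union_left (h : IsForest (S ∪ T) (V ∪ W)) (hd : Disjoint S T)
    (hS : S.Nonempty) (hV : ∀ v ∈ V, vertexLeaves v ⊆ S) (hW : ∀ v ∈ W, vertexLeaves v ⊆ T) :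
    IsForest S V := by
  have hWS : ∀ v ∈ W, Disjoint (vertexLeaves v) S := fun v hv => hd.symm.mono_left (hW v hv)
  have hS' : (S ∪ T) ∩ S = S := Finset.inter_eq_right.2 Finset.subset_union_left
  have hr := h.restrict (hS'.symm ▸ hS) fun v hv =>
    (Finset.mem_union.1 hv).imp (hV v) (hWS v)
  rwa [hS', Finset.filter_union, Finset.filter_true_of_mem hV, Finset.filter_false_of_mem,
    Finset.union_empty] at hr
  exact fun v hv hvS => (h.vertexLeaves_nonempty (Finset.mem_union_right _ hv)).ne_empty
    (Finset.disjoint_self_iff_empty _ |>.1 ((hWS v hv).mono_right hvS))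

theorem isForest_union_iff (hd : Disjoint S T) (hS : S.Nonempty) (hT : T.Nonempty)
    (hV : ∀ v ∈ V, vertexLeaves v ⊆ S) (hW : ∀ v ∈ W, vertexLeaves v ⊆ T) :
    IsForest (S ∪ T) (V ∪ W) ↔ IsForest S V ∧ IsForest T W :=
  ⟨fun h => ⟨h.of_union_left hd hS hV hW,
    IsForest.of_union_left (Finset.union_comm S T ▸ Finset.union_comm V W ▸ h) hd.symm hT hW hV⟩,
    fun h => h.1.union h.2 hd⟩

theorem IsTree.exists_of_mem {A B : Finset α} (h : IsTree (A ∪ B) V) (hv : s(A, B) ∈ V) :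
    ∃ V₁ V₂, IsTree A V₁ ∧ IsTree B V₂ ∧ Disjoint A B ∧ V.erase s(A, B) = V₁ ∪ V₂ := by
  generalize hX : A ∪ B = X at h
  cases h with
  | leaf a => simp at hv
  | @graft P Q V W hV hW hd =>
    have notMem_V : ∀ {C D}, C ∪ D = P ∪ Q → s(C, D) ∉ V := fun e hm => by
      obtain ⟨x, hx⟩ := hW.nonempty
      exact Finset.disjoint_right.1 hd hx
        ((hV.vertex _ hm).1 (e.symm.subset (Finset.mem_union_right _ hx)))
    have notMem_W : ∀ {C D}, C ∪ D = P ∪ Q → s(C, D) ∉ W := fun e hm => by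
      obtain ⟨x, hx⟩ := hV.nonempty
      exact Finset.disjoint_left.1 hd hx
        ((hW.vertex _ hm).1 (e.symm.subset (Finset.mem_union_left _ hx)))
    have e : s(A, B) = s(P, Q) := by simpa [notMem_V hX, notMem_W hX] using hv
    rw [e, Finset.erase_insert (by simp [notMem_V, notMem_W])]
    rcases Sym2.eq_iff.1 e with ⟨rfl, rfl⟩ | ⟨rfl, rfl⟩
    · exact ⟨V, W, hV, hW, hd, rfl⟩
    · exact ⟨W, V, hW, hV, hd.symm, Finset.union_comm _ _⟩

theorem IsForest.erase_vertex {A B : Finset α} (h : IsForest S V) (hv : s(A, B) ∈ V)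
    (hAB : A ∪ B ∈ roots S V) :
    IsForest S (V.erase s(A, B)) ∧ A ∈ roots S (V.erase s(A, B)) ∧
      B ∈ roots S (V.erase s(A, B)) := by
  have erase_tree {V : Finset (Sym2 (Finset α))} (ht : IsTree (A ∪ B) V) (hv : s(A, B) ∈ V) :
      IsForest (A ∪ B) (V.erase s(A, B)) ∧ roots (A ∪ B) (V.erase s(A, B)) = {A, B} := by
    obtain ⟨V₁, V₂, h₁, h₂, hd, e⟩ := ht.exists_of_mem hv
    rw [e, roots_union (.tree h₁) (.tree h₂) hd, h₁.roots_eq, h₂.roots_eq]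
    exact ⟨(IsForest.tree h₁).union (.tree h₂) hd, rfl⟩
  rcases h.split hAB with ⟨rfl, ht⟩ | ⟨S', V₁, V₂, hd, rfl, rfl, ht, hf⟩
  · obtain ⟨hF, hR⟩ := erase_tree ht hv
    simpa [hR] using hF
  · have hv₂ : s(A, B) ∉ V₂ := fun hv₂ => ht.nonempty.ne_empty
      ((Finset.disjoint_self_iff_empty _).1 (hd.mono_right (hf.vertex _ hv₂).1))
    obtain ⟨hF, hR⟩ := erase_tree ht ((Finset.mem_union.1 hv).resolve_right hv₂)
    rw [Finset.erase_union_distrib, Finset.erase_eq_of_notMem hv₂, roots_union hF hf hd, hR]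
    exact ⟨hF.union hf hd, by simp, by simp⟩

theorem isForest_insert_union_iff {a b : Finset α} (hd : Disjoint S T) (ha : a ⊆ S) (hb : b ⊆ T)
    (hV : ∀ v ∈ V, vertexLeaves v ⊆ S) (hW : ∀ v ∈ W, vertexLeaves v ⊆ T) :
    IsForest (S ∪ T) (insert s(a, b) (V ∪ W)) ↔
      IsForest S V ∧ IsForest T W ∧ a ∈ roots S V ∧ b ∈ roots T W := by
  refine ⟨fun h => ?_, fun ⟨h₁, h₂, h₃, h₄⟩ => h₁.graft h₂ hd h₃ h₄⟩
  have hab := (h.vertex _ (Finset.mem_insert_self _ _)).2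
  obtain ⟨x, hx⟩ := (hab a (Sym2.mem_mk_left a b)).1
  obtain ⟨y, hy⟩ := (hab b (Sym2.mem_mk_right a b)).1
  have not_subset : ∀ v ∈ V ∪ W, ¬ a ∪ b ⊆ vertexLeaves v := by
    intro v hv hs
    rcases Finset.mem_union.1 hv with hv | hv
    · exact Finset.disjoint_right.1 hd (hb hy) (hV v hv (hs (Finset.mem_union_right _ hy)))
    · exact Finset.disjoint_left.1 hd (ha hx) (hW v hv (hs (Finset.mem_union_left _ hx)))
  have hroot : a ∪ b ∈ roots (S ∪ T) (insert s(a, b) (V ∪ W)) := by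
    refine mem_roots.2 ⟨Or.inr ⟨_, Finset.mem_insert_self _ _, rfl⟩, fun v hv hm => ?_⟩
    rcases Finset.mem_insert.1 hv with rfl | hv
    · exact (hab _ hm).2.ne rfl
    · exact not_subset v hv (subset_vertexLeaves hm)
  have hF := h.erase_vertex (Finset.mem_insert_self _ _) hroot
  rw [Finset.erase_insert fun hv => not_subset _ hv subset_rfl] at hF
  obtain ⟨h₁, h₂⟩ := (isForest_union_iff hd ⟨x, ha hx⟩ ⟨y, hb hy⟩ hV hW).1 hF.1
  rw [roots_union h₁ h₂ hd, Finset.mem_union, Finset.mem_union] at hF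
  refine ⟨h₁, h₂, hF.2.1.resolve_right fun haT => ?_, hF.2.2.resolve_left fun hbS => ?_⟩
  · exact Finset.disjoint_left.1 hd (ha hx) ((h₂.of_mem_roots haT).2 hx)
  · exact Finset.disjoint_left.1 hd ((h₁.of_mem_roots hbS).2 hy) (hb hy)

end Combinatorics

section Lists

variable {α M N P : Type*} [AddCommGroup M] [AddCommGroup N] [AddCommGroup P]

/-- An inner vertex together with a local orientation: `(A, B)` has the incoming half-edges `A` and
`B`, each given by its set of leaves, and the local orientation `root ∧ A ∧ B`. -/
abbrev OrientedVertex (α : Type*) := Finset α × Finset α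

/-- The function `f` of the ordered inner vertices changes sign when a global or a local orientation
is reversed. -/
structure IsAlternating (f : List (OrientedVertex α) → M) : Prop where
  swap : ∀ l₁ l₂ v w, f (l₁ ++ v :: w :: l₂) = -f (l₁ ++ w :: v :: l₂)
  flip : ∀ l₁ l₂ A B, f (l₁ ++ (A, B) :: l₂) = -f (l₁ ++ (B, A) :: l₂)

namespace IsAlternating

variable {f g : List (OrientedVertex α) → M}

theorem cons (hf : IsAlternating f) (v : OrientedVertex α) :
    IsAlternating fun l => f (v :: l) where
  swap l₁ := hf.swap (v :: l₁)
  flip l₁ := hf.flip (v :: l₁)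

theorem add (hf : IsAlternating f) (hg : IsAlternating g) : IsAlternating fun l => f l + g l where
  swap l₁ l₂ v w := by rw [hf.swap, hg.swap, neg_add]
  flip l₁ l₂ A B := by rw [hf.flip, hg.flip, neg_add]

theorem map (hf : IsAlternating f) (φ : M →+ N) : IsAlternating fun l => φ (f l) where
  swap l₁ l₂ v w := by rw [hf.swap, map_neg]
  flip l₁ l₂ A B := by rw [hf.flip, map_neg]

theorem neg_one_pow_length_smul [Module ℚ M] (hf : IsAlternating f) :
    IsAlternating fun l => (-1 : ℚ) ^ l.length • f l where
  swap l₁ l₂ v w := by rw [hf.swap]; simp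
  flip l₁ l₂ A B := by rw [hf.flip]; simp

theorem exists_smul_eq_of_perm (hf : IsAlternating f) {l l' : List (OrientedVertex α)}
    (h : l.Perm l') : ∃ ε : ℤˣ, f l = ε • f l' := by
  induction h generalizing f with
  | nil => exact ⟨1, (one_smul _ _).symm⟩
  | cons v _ ih => exact ih (hf.cons v)
  | swap v w l => exact ⟨-1, by rw [Units.neg_smul, one_smul]; exact hf.swap [] l w v⟩
  | trans _ _ ih₁ ih₂ =>
    obtain ⟨ε₁, h₁⟩ := ih₁ hf
    obtain ⟨ε₂, h₂⟩ := ih₂ hf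
    exact ⟨ε₁ * ε₂, by rw [h₁, h₂, mul_smul]⟩

theorem exists_smul_eq_of_forall₂ (hf : IsAlternating f) {l l' : List (OrientedVertex α)}
    (h : List.Forall₂ (fun v w => s(v.1, v.2) = s(w.1, w.2)) l l') :
    ∃ ε : ℤˣ, f l = ε • f l' := by
  induction h generalizing f with
  | nil => exact ⟨1, (one_smul _ _).symm⟩
  | @cons v w l l' hvw _ ih =>
    obtain ⟨ε, hε⟩ := ih (hf.cons v)
    rcases Sym2.mk_eq_mk_iff.1 hvw with rfl | rfl
    · exact ⟨ε, hε⟩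
    · refine ⟨-ε, hε.trans ?_⟩
      rw [Units.neg_smul, ← smul_neg]
      exact congrArg _ (hf.flip [] l' w.2 w.1)

theorem exists_smul_eq_of_map_perm (hf : IsAlternating f) {l l' : List (OrientedVertex α)}
    (h : (l.map fun v => s(v.1, v.2)).Perm (l'.map fun v => s(v.1, v.2))) :
    ∃ ε : ℤˣ, f l = ε • f l' := by
  have h' : List.Forall₂ (fun e v => e = s(v.1, v.2)) (l'.map fun v => s(v.1, v.2)) l' :=
    List.forall₂_map_left_iff.2 (List.forall₂_refl l')
  obtain ⟨m, hlm, hm⟩ := List.perm_comp_forall₂ h h'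
  obtain ⟨ε₁, h₁⟩ := hf.exists_smul_eq_of_forall₂ (List.forall₂_map_left_iff.1 hlm)
  obtain ⟨ε₂, h₂⟩ := hf.exists_smul_eq_of_perm hm
  exact ⟨ε₁ * ε₂, by rw [h₁, h₂, mul_smul]⟩

end IsAlternating

/-- The function `f` of two lists of inner vertices changes sign when an orientation is reversed in
one of the two lists. -/
structure IsBialternating (f : List (OrientedVertex α) → List (OrientedVertex α) → M) : Prop where
  left : ∀ R, IsAlternating fun L => f L R
  right : ∀ L, IsAlternating (f L)

/-- The oriented vertices `(a, b)` with `a ⊆ A` and `b ⊆ B`, for `v = (A, B)`: they are what may be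
left of the inner vertex `v` after other inner vertices have been removed. -/
def subvertices (v : OrientedVertex α) : Finset (OrientedVertex α) :=
  v.1.powerset ×ˢ v.2.powerset

theorem mem_subvertices {u v : OrientedVertex α} : u ∈ subvertices v ↔ u.1 ⊆ v.1 ∧ u.2 ⊆ v.2 := by
  simp [subvertices]

theorem sum_subvertices_swap (A B : Finset α) (f : OrientedVertex α → M) :
    ∑ u ∈ subvertices (B, A), f u = ∑ u ∈ subvertices (A, B), f u.swap :=
  Finset.sum_equiv (Equiv.prodComm _ _) (by simp [mem_subvertices, and_comm]) (by simp)

variable [Module ℚ M] [Module ℚ N] [Module ℚ P]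

/-- Distributing a first inner vertex `u` over the two factors. In the second factor `u` has to move
past the inner vertices of the first one, hence the sign. -/
def prepend (u : OrientedVertex α) :
    (List (OrientedVertex α) → List (OrientedVertex α) → M) →ₗ[ℚ]
      List (OrientedVertex α) → List (OrientedVertex α) → M where
  toFun f L R := f (u :: L) R + (-1 : ℚ) ^ L.length • f L (u :: R)
  map_add' f g := by
    ext L R
    simp only [Pi.add_apply, smul_add]
    abel
  map_smul' c f := by
    ext L R
    simp only [Pi.smul_apply, RingHom.id_apply, smul_add, smul_comm c]

theorem prepend_apply (u : OrientedVertex α)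
    (f : List (OrientedVertex α) → List (OrientedVertex α) → M) (L R : List (OrientedVertex α)) :
    prepend u f L R = f (u :: L) R + (-1 : ℚ) ^ L.length • f L (u :: R) := rfl

/-- The signed sum of `f L R` over the ways to distribute the inner vertices over two lists `L` and
`R`, each inner vertex being replaced by one of its `subvertices`. -/
def splitSum : List (OrientedVertex α) →
    (List (OrientedVertex α) → List (OrientedVertex α) → M) →ₗ[ℚ] M
  | [] => LinearMap.proj [] ∘ₗ LinearMap.proj []
  | v :: l => ∑ u ∈ subvertices v, splitSum l ∘ₗ prepend u

section SplitSum

variable {f g : List (OrientedVertex α) → List (OrientedVertex α) → M}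

@[simp] theorem splitSum_nil : splitSum [] f = f [] [] := rfl

theorem splitSum_cons (v : OrientedVertex α) (l : List (OrientedVertex α)) :
    splitSum (v :: l) f = ∑ u ∈ subvertices v, splitSum l (prepend u f) := by
  simp [splitSum]

theorem splitSum_congr {p : OrientedVertex α → Prop} {l : List (OrientedVertex α)}
    (hl : ∀ v ∈ l, ∀ u ∈ subvertices v, p u)
    (hfg : ∀ L R, (∀ u ∈ L, p u) → (∀ u ∈ R, p u) → f L R = g L R) :
    splitSum l f = splitSum l g := by
  induction l generalizing f g with
  | nil => exact hfg [] [] (by simp) (by simp)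
  | cons v l ih =>
    rw [List.forall_mem_cons] at hl
    simp only [splitSum_cons]
    refine Finset.sum_congr rfl fun u hu => ih hl.2 fun L R hL hR => ?_
    rw [prepend_apply, prepend_apply, hfg _ _ (List.forall_mem_cons.2 ⟨hl.1 u hu, hL⟩) hR,
      hfg _ _ hL (List.forall_mem_cons.2 ⟨hl.1 u hu, hR⟩)]

theorem map_splitSum (φ : M →ₗ[ℚ] N) (l : List (OrientedVertex α)) :
    φ (splitSum l f) = splitSum l fun L R => φ (f L R) := by
  induction l generalizing f with
  | nil => rfl
  | cons v l ih =>
    simp only [splitSum_cons, map_sum, ih]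
    refine Finset.sum_congr rfl fun u _ => congrArg _ (funext₂ fun L R => ?_)
    simp only [prepend_apply, map_add, map_smul]

theorem map₂_splitSum (B : M →ₗ[ℚ] N →ₗ[ℚ] P) (l m : List (OrientedVertex α))
    {g : List (OrientedVertex α) → List (OrientedVertex α) → N} :
    B (splitSum l f) (splitSum m g) =
      splitSum l fun L R => splitSum m fun L' R' => B (f L R) (g L' R') := by
  rw [← LinearMap.flip_apply, map_splitSum]
  exact congrArg _ (funext₂ fun L R => map_splitSum (B (f L R)) m)

theorem splitSum_append (l m : List (OrientedVertex α)) :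
    splitSum (l ++ m) f = splitSum l fun L R => splitSum m fun L' R' =>
      (-1 : ℚ) ^ (R.length * L'.length) • f (L ++ L') (R ++ R') := by
  induction l generalizing f with
  | nil => simp
  | cons v l ih =>
    simp only [List.cons_append, splitSum_cons, ih]
    refine Finset.sum_congr rfl fun u _ => congrArg _ (funext₂ fun L R => ?_)
    rw [prepend_apply, ← map_smul, ← map_add]
    refine congrArg _ (funext₂ fun L' R' => ?_)
    simp only [prepend_apply, Pi.add_apply, Pi.smul_apply, List.cons_append, List.length_append,
      List.length_cons, smul_add, smul_smul]
    ring_nf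

end SplitSum

namespace IsBialternating

variable {f : List (OrientedVertex α) → List (OrientedVertex α) → M}

theorem prepend (hf : IsBialternating f) (u : OrientedVertex α) :
    IsBialternating (prepend u f) where
  left R := ((hf.left R).cons u).add (hf.left (u :: R)).neg_one_pow_length_smul
  right L := (hf.right (u :: L)).add <|
    ((hf.right L).cons u).map (LinearMap.lsmul ℚ M ((-1 : ℚ) ^ L.length)).toAddMonoidHom

theorem prepend_prepend (hf : IsBialternating f) (u v : OrientedVertex α) :
    Bessel.prepend v (Bessel.prepend u f) = -Bessel.prepend u (Bessel.prepend v f) := by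
  ext L R
  have hL : f (u :: v :: L) R = -f (v :: u :: L) R := (hf.left R).swap [] L u v
  have hR : f L (u :: v :: R) = -f L (v :: u :: R) := (hf.right L).swap [] R u v
  simp only [prepend_apply, Pi.neg_apply, List.length_cons, hL, hR, pow_succ, smul_add, smul_neg,
    mul_neg_one, neg_smul]
  abel

theorem prepend_swap (hf : IsBialternating f) (u : OrientedVertex α) :
    Bessel.prepend u.swap f = -Bessel.prepend u f := by
  ext L R
  have hL : f (u.swap :: L) R = -f (u :: L) R := (hf.left R).flip [] L u.2 u.1
  have hR : f L (u.swap :: R) = -f L (u :: R) := (hf.right L).flip [] R u.2 u.1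
  rw [prepend_apply, Pi.neg_apply, Pi.neg_apply, prepend_apply, hL, hR, smul_neg, neg_add]

theorem splitSum (hf : IsBialternating f) : IsAlternating fun l => splitSum l f where
  swap l₁ l₂ v w := by
    induction l₁ generalizing f with
    | nil =>
      simp only [List.nil_append, splitSum_cons]
      rw [Finset.sum_comm, ← Finset.sum_neg_distrib]
      refine Finset.sum_congr rfl fun u _ => ?_
      rw [← Finset.sum_neg_distrib]
      refine Finset.sum_congr rfl fun u' _ => ?_
      rw [hf.prepend_prepend, map_neg]
    | cons x l₁ ih =>
      simp only [List.cons_append, splitSum_cons, ih (hf.prepend _), Finset.sum_neg_distrib]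
  flip l₁ l₂ A B := by
    induction l₁ generalizing f with
    | nil =>
      simp only [List.nil_append, splitSum_cons]
      rw [sum_subvertices_swap, ← Finset.sum_neg_distrib]
      refine Finset.sum_congr rfl fun u _ => ?_
      rw [hf.prepend_swap, map_neg]
    | cons x l₁ ih =>
      simp only [List.cons_append, splitSum_cons, ih (hf.prepend _), Finset.sum_neg_distrib]

end IsBialternating

end Lists

section ListClass

variable {α : Type*} [DecidableEq α] {S T : Finset α} {l m : List (OrientedVertex α)}

/-- The set of underlying unoriented vertices of a list of oriented vertices. -/
def unoriented (l : List (OrientedVertex α)) : Finset (Sym2 (Finset α)) :=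
  (l.map fun v => s(v.1, v.2)).toFinset

theorem unoriented_cons (v : OrientedVertex α) (l : List (OrientedVertex α)) :
    unoriented (v :: l) = insert s(v.1, v.2) (unoriented l) := by
  simp [unoriented]

theorem unoriented_append (l m : List (OrientedVertex α)) :
    unoriented (l ++ m) = unoriented l ∪ unoriented m := by
  simp [unoriented]

theorem forall_mem_unoriented {p : Sym2 (Finset α) → Prop} :
    (∀ v ∈ unoriented l, p v) ↔ ∀ v ∈ l, p s(v.1, v.2) := by
  simp only [unoriented, List.mem_toFinset, List.forall_mem_map]

/-- The list `l` consists of the inner vertices, in some order and with some local orientations, of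
a forest with set of leaves `S`. -/
structure IsForestList (S : Finset α) (l : List (OrientedVertex α)) : Prop where
  nodup : (l.map fun v => s(v.1, v.2)).Nodup
  isForest : IsForest S (unoriented l)

theorem isForestList_congr {l' : List (OrientedVertex α)}
    (h : (l.map fun v => s(v.1, v.2)).Perm (l'.map fun v => s(v.1, v.2))) :
    IsForestList S l ↔ IsForestList S l' := by
  have e : unoriented l = unoriented l' := List.toFinset_eq_of_perm _ _ h
  exact ⟨fun hl => ⟨h.nodup_iff.1 hl.nodup, e ▸ hl.isForest⟩,
    fun hl => ⟨h.nodup_iff.2 hl.nodup, e ▸ hl.isForest⟩⟩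

theorem OrientedForest.isForestList (F : OrientedForest S) : IsForestList S F.vertices :=
  ⟨F.nodup, F.isForest⟩

theorem IsForestList.exists_vertices_eq (h : IsForestList S l) :
    ∃ F : OrientedForest S, F.vertices = l :=
  ⟨⟨l, h.nodup, h.isForest⟩, rfl⟩

theorem isForestList_append_iff (hd : Disjoint S T) (hS : S.Nonempty) (hT : T.Nonempty)
    (hl : ∀ v ∈ l, v.1 ∪ v.2 ⊆ S) (hm : ∀ v ∈ m, v.1 ∪ v.2 ⊆ T) :
    IsForestList (S ∪ T) (l ++ m) ↔ IsForestList S l ∧ IsForestList T m := by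
  refine ⟨fun ⟨hn, hf⟩ => ?_, fun ⟨h₁, h₂⟩ => ?_⟩
  · rw [List.map_append, List.nodup_append'] at hn
    rw [unoriented_append, isForest_union_iff hd hS hT (forall_mem_unoriented.2 hl)
      (forall_mem_unoriented.2 hm)] at hf
    exact ⟨⟨hn.1, hf.1⟩, ⟨hn.2.1, hf.2⟩⟩
  · obtain ⟨F, rfl⟩ := h₁.exists_vertices_eq
    obtain ⟨G, rfl⟩ := h₂.exists_vertices_eq
    exact (F.disjointUnion hd G).isForestList

theorem IsForestList.of_cons_append {a b : Finset α} (hd : Disjoint S T) (ha : a ⊆ S) (hb : b ⊆ T)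
    (hl : ∀ v ∈ l, v.1 ∪ v.2 ⊆ S) (hm : ∀ v ∈ m, v.1 ∪ v.2 ⊆ T)
    (h : IsForestList (S ∪ T) ((a, b) :: (l ++ m))) :
    IsForestList S l ∧ IsForestList T m ∧ a ∈ roots S (unoriented l) ∧
      b ∈ roots T (unoriented m) := by
  obtain ⟨hn, hf⟩ := h
  rw [List.map_cons, List.nodup_cons, List.map_append, List.nodup_append'] at hn
  rw [unoriented_cons, unoriented_append, isForest_insert_union_iff hd ha hb
    (forall_mem_unoriented.2 hl) (forall_mem_unoriented.2 hm)] at hf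
  exact ⟨⟨hn.2.1, hf.1⟩, ⟨hn.2.2.1, hf.2.1⟩, hf.2.2⟩

open Classical in
/-- The element of `Bess(S)` given by a list of oriented vertices, which is zero if they are not the
inner vertices of a forest. -/
noncomputable def listCls (S : Finset α) (l : List (OrientedVertex α)) : Bess S :=
  if h : IsForestList S l then cls ⟨l, h.nodup, h.isForest⟩ else 0

@[simp] theorem listCls_vertices (F : OrientedForest S) : listCls S F.vertices = cls F :=
  dif_pos F.isForestList

theorem listCls_of_not (h : ¬ IsForestList S l) : listCls S l = 0 :=
  dif_neg h

theorem isAlternating_listCls (S : Finset α) : IsAlternating (listCls S) := by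
  have key {l l' : List (OrientedVertex α)}
      (h : (l.map fun v => s(v.1, v.2)).Perm (l'.map fun v => s(v.1, v.2)))
      (hO : ∀ F G : OrientedForest S, F.vertices = l → G.vertices = l' → F.Opposite G) :
      listCls S l = -listCls S l' := by
    have e : IsForestList S l ↔ IsForestList S l' := isForestList_congr h
    by_cases hl : IsForestList S l
    · obtain ⟨F, hF⟩ := hl.exists_vertices_eq
      obtain ⟨G, hG⟩ := (e.1 hl).exists_vertices_eq
      rw [← hF, ← hG, listCls_vertices, listCls_vertices]
      exact eq_neg_of_add_eq_zero_left (cls_add_cls (hO F G hF hG))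
    · rw [listCls_of_not hl, listCls_of_not (mt e.2 hl), neg_zero]
  exact ⟨fun l₁ l₂ v w => key (((List.Perm.swap w v l₂).append_left l₁).map _)
      fun F G => .swap l₁ l₂ v w,
    fun l₁ l₂ A B => key (by simp [Sym2.eq_swap (a := A)]) fun F G => .flip l₁ l₂ A B⟩

theorem exists_cls_eq_smul_cls {F G : OrientedForest S} (h : F.vertexSet = G.vertexSet) :
    ∃ ε : ℤˣ, cls F = ε • cls G := by
  rw [← listCls_vertices, ← listCls_vertices]
  exact (isAlternating_listCls S).exists_smul_eq_of_map_perm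
    (List.perm_of_nodup_nodup_toFinset_eq F.nodup G.nodup h)

@[simp] theorem compE_cls (h : Disjoint S T) (F : OrientedForest S) (G : OrientedForest T) :
    compE h (cls F) (cls G) = cls (F.disjointUnion h G) := by
  rw [compE, liftBess_cls, liftBess_cls]

@[simp] theorem compOmega_cls (h : Disjoint S T) (F : OrientedForest S) (G : OrientedForest T) :
    compOmega h (cls F) (cls G) = graftSum h F G := by
  rw [compOmega, liftBess_cls, liftBess_cls]

theorem listCls_append (hd : Disjoint S T) (hS : S.Nonempty) (hT : T.Nonempty)
    (hl : ∀ v ∈ l, v.1 ∪ v.2 ⊆ S) (hm : ∀ v ∈ m, v.1 ∪ v.2 ⊆ T) :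
    listCls (S ∪ T) (l ++ m) = compE hd (listCls S l) (listCls T m) := by
  have e := isForestList_append_iff hd hS hT hl hm
  by_cases h₁ : IsForestList S l
  · by_cases h₂ : IsForestList T m
    · obtain ⟨F, rfl⟩ := h₁.exists_vertices_eq
      obtain ⟨G, rfl⟩ := h₂.exists_vertices_eq
      rw [listCls_vertices, listCls_vertices, compE_cls]
      exact listCls_vertices (F.disjointUnion hd G)
    · rw [listCls_of_not h₂, listCls_of_not fun h => h₂ (e.1 h).2, map_zero]
  · rw [listCls_of_not h₁, listCls_of_not fun h => h₁ (e.1 h).1, map_zero, LinearMap.zero_apply]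

theorem graftSum_eq_sum_listCls (h : Disjoint S T) (F : OrientedForest S) (G : OrientedForest T) :
    graftSum h F G = ∑ a ∈ F.trees, ∑ b ∈ G.trees,
      listCls (S ∪ T) ((a, b) :: (F.vertices ++ G.vertices)) := by
  rw [graftSum, ← Finset.sum_attach F.trees]
  refine Finset.sum_congr rfl fun a _ => ?_
  rw [← Finset.sum_attach G.trees]
  exact Finset.sum_congr rfl fun b _ => (listCls_vertices (F.graft h G a.2 b.2)).symm

namespace OrientedForest

/-- The vertex `v` lies in a single tree of the forest `F`. -/
def LiesInTree (F : OrientedForest S) (v : OrientedVertex α) : Prop :=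
  ∃ r ∈ F.trees, v.1 ∪ v.2 ⊆ r

theorem LiesInTree.subset {F : OrientedForest S} {v : OrientedVertex α} (h : F.LiesInTree v) :
    v.1 ∪ v.2 ⊆ S :=
  let ⟨_, hr, hv⟩ := h
  hv.trans (F.isForest.of_mem_roots hr).2

theorem liesInTree_of_mem_subvertices (F : OrientedForest S) :
    ∀ v ∈ F.vertices, ∀ u ∈ subvertices v, F.LiesInTree u := by
  intro v hv u hu
  obtain ⟨r, hr, hvr⟩ := F.isForest.exists_mem_roots_of_vertex
    (List.mem_toFinset.2 (List.mem_map_of_mem hv))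
  have hu := mem_subvertices.1 hu
  exact ⟨r, hr, (Finset.union_subset_union hu.1 hu.2).trans hvr⟩

theorem exists_mem_trees_superset {F F' : OrientedForest S}
    (hF : ∀ v ∈ F'.vertices, F.LiesInTree v) {a : Finset α} (ha : a ∈ F'.trees) :
    ∃ r ∈ F.trees, a ⊆ r := by
  rcases (mem_roots.1 ha).1 with ⟨x, hx, rfl⟩ | ⟨v, hv, rfl⟩
  · exact (F.isForest.exists_mem_roots_of_mem hx).imp fun r hr =>
      ⟨hr.1, Finset.singleton_subset_iff.2 hr.2⟩
  · exact forall_mem_unoriented (p := fun v => ∃ r ∈ F.trees, vertexLeaves v ⊆ r).2 hF v hv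

theorem sum_sum_powerset_trees {M : Type*} [AddCommMonoid M] {F F' : OrientedForest S}
    (hF : ∀ v ∈ F'.vertices, F.LiesInTree v) {f : Finset α → M}
    (hf : ∀ a ⊆ S, a ∉ F'.trees → f a = 0) :
    ∑ r ∈ F.trees, ∑ a ∈ r.powerset, f a = ∑ a ∈ F'.trees, f a :=
  sum_sum_powerset_eq_sum F.isForest.pairwiseDisjoint_roots
    (fun _ ha => ⟨(F'.isForest.of_mem_roots ha).1, exists_mem_trees_superset hF ha⟩)
    fun _ hr _ har => hf _ (har.trans (F.isForest.of_mem_roots hr).2)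

end OrientedForest

variable {F : OrientedForest S} {G : OrientedForest T}

theorem sum_subvertices_trees_eq_graftSum (hd : Disjoint S T) {F' : OrientedForest S}
    {G' : OrientedForest T} (hF : ∀ v ∈ F'.vertices, F.LiesInTree v)
    (hG : ∀ v ∈ G'.vertices, G.LiesInTree v) :
    ∑ r ∈ F.trees, ∑ s ∈ G.trees, ∑ u ∈ subvertices (r, s),
      listCls (S ∪ T) (u :: (F'.vertices ++ G'.vertices)) = graftSum hd F' G' := by
  have mem_trees {a b : Finset α} (ha : a ⊆ S) (hb : b ⊆ T) := IsForestList.of_cons_append hd ha hb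
    (fun v hv => (hF v hv).subset) fun v hv => (hG v hv).subset
  rw [graftSum_eq_sum_listCls, ← OrientedForest.sum_sum_powerset_trees hF]
  · simp only [subvertices, Finset.sum_product]
    refine Finset.sum_congr rfl fun r hr => ?_
    rw [Finset.sum_comm]
    refine Finset.sum_congr rfl fun a ha => OrientedForest.sum_sum_powerset_trees hG
      fun b hb hbG => listCls_of_not fun h => hbG (mem_trees ?_ hb h).2.2.2
    exact (Finset.mem_powerset.1 ha).trans (F.isForest.of_mem_roots hr).2
  · exact fun a ha haF => Finset.sum_eq_zero fun b hb => listCls_of_not fun h =>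
      haF (mem_trees ha (G'.isForest.of_mem_roots hb).2 h).2.2.1

theorem sum_subvertices_trees_eq_compOmega (hd : Disjoint S T) (hl : ∀ v ∈ l, F.LiesInTree v)
    (hm : ∀ v ∈ m, G.LiesInTree v) :
    ∑ r ∈ F.trees, ∑ s ∈ G.trees, ∑ u ∈ subvertices (r, s), listCls (S ∪ T) (u :: (l ++ m)) =
      compOmega hd (listCls S l) (listCls T m) := by
  by_cases h : IsForestList S l ∧ IsForestList T m
  · obtain ⟨F', rfl⟩ := h.1.exists_vertices_eq
    obtain ⟨G', rfl⟩ := h.2.exists_vertices_eq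
    rw [listCls_vertices, listCls_vertices, compOmega_cls,
      sum_subvertices_trees_eq_graftSum hd hl hm]
  · have hzero : compOmega hd (listCls S l) (listCls T m) = 0 := by
      rcases not_and_or.1 h with h | h
      · rw [listCls_of_not h, map_zero, LinearMap.zero_apply]
      · rw [listCls_of_not h, map_zero]
    rw [hzero]
    refine Finset.sum_eq_zero fun r hr => Finset.sum_eq_zero fun s hs =>
      Finset.sum_eq_zero fun u hu => listCls_of_not fun hu' => h ?_
    obtain ⟨h₁, h₂⟩ := mem_subvertices.1 hu
    have h' := hu'.of_cons_append hd (h₁.trans (F.isForest.of_mem_roots hr).2)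
      (h₂.trans (G.isForest.of_mem_roots hs).2) (fun v hv => (hl v hv).subset)
      fun v hv => (hm v hv).subset
    exact ⟨h'.1, h'.2.1⟩

end ListClass

section Coproduct

variable {α : Type*} [DecidableEq α] {S T : Finset α}

theorem bilin_ext {M : Type*} [AddCommGroup M] [Module ℚ M]
    {f g : Bess S →ₗ[ℚ] Bess T →ₗ[ℚ] M} (h : ∀ F G, f (cls F) (cls G) = g (cls F) (cls G)) :
    f = g :=
  hom_ext fun F => hom_ext fun G => h F G

theorem OrientedForest.length_lt (F : OrientedForest S) : F.vertices.length < S.card := by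
  have := F.isForest.card_lt
  rwa [List.toFinset_card_of_nodup F.nodup, List.length_map] at this

theorem OrientedForest.length_mem_range (F : OrientedForest S) :
    F.vertices.length ∈ Finset.range (S.card + 1) :=
  Finset.mem_range.2 (F.length_lt.trans (Nat.lt_succ_self _))

theorem projEnd_cls (F : OrientedForest S) (n : ℕ) :
    projEnd S n (cls F) = if F.vertices.length = n then cls F else 0 := by
  rw [projEnd, LinearMap.comp_apply, proj, liftBess_cls]
  split_ifs <;> rfl

theorem parity_cls (F : OrientedForest S) :
    parity S (cls F) = (-1 : ℚ) ^ F.vertices.length • cls F := by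
  simp only [parity, LinearMap.sum_apply, LinearMap.smul_apply, projEnd_cls, smul_ite, smul_zero]
  rw [Finset.sum_ite_eq, if_pos F.length_mem_range]

theorem koszul_cls (x : Bess S) (F : OrientedForest S) (G : OrientedForest T) (y : Bess T) :
    koszul S T ((x ⊗ₜ[ℚ] cls F) ⊗ₜ[ℚ] (cls G ⊗ₜ[ℚ] y)) =
      (-1 : ℚ) ^ (F.vertices.length * G.vertices.length) •
        ((x ⊗ₜ[ℚ] cls G) ⊗ₜ[ℚ] (cls F ⊗ₜ[ℚ] y)) := by
  simp only [koszul, LinearMap.sum_apply, LinearMap.smul_apply, LinearMap.comp_apply,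
    TensorProduct.map_tmul, projEnd_cls, LinearMap.id_apply, LinearEquiv.coe_coe,
    TensorProduct.tensorTensorTensorComm_tmul]
  rw [Finset.sum_eq_single_of_mem _ F.length_mem_range,
    Finset.sum_eq_single_of_mem _ G.length_mem_range, if_pos rfl, if_pos rfl]
  · exact fun q _ hq => by simp [hq.symm]
  · exact fun p _ hp => by simp [hp.symm]

theorem compTensor_tmul_cls (μ ν : Bess S →ₗ[ℚ] Bess T →ₗ[ℚ] Bess (S ∪ T)) (x : Bess S)
    (F : OrientedForest S) (G : OrientedForest T) (y : Bess T) :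
    compTensor μ ν (x ⊗ₜ[ℚ] cls F) (cls G ⊗ₜ[ℚ] y) =
      (-1 : ℚ) ^ (F.vertices.length * G.vertices.length) • (μ x (cls G) ⊗ₜ[ℚ] ν (cls F) y) := by
  rw [compTensor, koszul_cls, map_smul, TensorProduct.map_tmul, TensorProduct.lift.tmul,
    TensorProduct.lift.tmul]

/-- `compTensor` as a bilinear map. -/
noncomputable def compTensorBilin (μ ν : Bess S →ₗ[ℚ] Bess T →ₗ[ℚ] Bess (S ∪ T)) :
    Bess S ⊗[ℚ] Bess S →ₗ[ℚ] Bess T ⊗[ℚ] Bess T →ₗ[ℚ] Bess (S ∪ T) ⊗[ℚ] Bess (S ∪ T) :=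
  (TensorProduct.mk ℚ _ _).compr₂
    (TensorProduct.map (TensorProduct.lift μ) (TensorProduct.lift ν) ∘ₗ koszul S T)

theorem compTensorBilin_apply (μ ν : Bess S →ₗ[ℚ] Bess T →ₗ[ℚ] Bess (S ∪ T))
    (X : Bess S ⊗[ℚ] Bess S) (Y : Bess T ⊗[ℚ] Bess T) :
    compTensorBilin μ ν X Y = compTensor μ ν X Y :=
  rfl

theorem listCls_eq_zero_or_exists (S : Finset α) (l : List (OrientedVertex α)) :
    listCls S l = 0 ∨ ∃ F : OrientedForest S, F.vertices = l ∧ listCls S l = cls F := by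
  by_cases h : IsForestList S l
  · exact Or.inr ⟨⟨l, h.nodup, h.isForest⟩, rfl, dif_pos h⟩
  · exact Or.inl (listCls_of_not h)

theorem parity_listCls (l : List (OrientedVertex α)) :
    parity S (listCls S l) = (-1 : ℚ) ^ l.length • listCls S l := by
  rcases listCls_eq_zero_or_exists S l with h | ⟨F, rfl, h⟩
  · rw [h, map_zero, smul_zero]
  · rw [h, parity_cls]

theorem compTensor_tmul_listCls (μ ν : Bess S →ₗ[ℚ] Bess T →ₗ[ℚ] Bess (S ∪ T)) (x : Bess S)
    (l m : List (OrientedVertex α)) (y : Bess T) :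
    compTensor μ ν (x ⊗ₜ[ℚ] listCls S l) (listCls T m ⊗ₜ[ℚ] y) =
      (-1 : ℚ) ^ (l.length * m.length) • (μ x (listCls T m) ⊗ₜ[ℚ] ν (listCls S l) y) := by
  rcases listCls_eq_zero_or_exists S l with h | ⟨F, rfl, h⟩
  · simp [h, ← compTensorBilin_apply]
  · rcases listCls_eq_zero_or_exists T m with h' | ⟨G, rfl, h'⟩
    · simp [h', ← compTensorBilin_apply]
    · rw [h, h', compTensor_tmul_cls]

theorem IsAlternating.add_eq_zero {M : Type*} [AddCommGroup M] {f : List (OrientedVertex α) → M}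
    (hf : IsAlternating f) {F G : OrientedForest S} (h : F.Opposite G) :
    f F.vertices + f G.vertices = 0 := by
  rw [add_eq_zero_iff_eq_neg]
  cases h with
  | swap l₁ l₂ v w hF hG => rw [hF, hG, hf.swap]
  | flip l₁ l₂ A B hF hG => rw [hF, hG, hf.flip]

theorem isBialternating_listCls_tmul (S : Finset α) :
    IsBialternating fun L R => listCls S L ⊗ₜ[ℚ] listCls S R where
  left R := (isAlternating_listCls S).map
    ((TensorProduct.mk ℚ (Bess S) (Bess S)).flip (listCls S R)).toAddMonoidHom
  right L := (isAlternating_listCls S).map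
    (TensorProduct.mk ℚ (Bess S) (Bess S) (listCls S L)).toAddMonoidHom

/-- The coproduct of the Bessel operad. It distributes the inner vertices over the two factors in
all possible ways; in each factor, the vertex `(A, B)` becomes the sum of the vertices `(a, b)` with
`a ⊆ A` and `b ⊆ B` which make up a forest with the other vertices of the factor. -/
noncomputable def coproduct (S : Finset α) : Bess S →ₗ[ℚ] Bess S ⊗[ℚ] Bess S :=
  liftBess (fun F => splitSum F.vertices fun L R => listCls S L ⊗ₜ[ℚ] listCls S R)
    fun _ _ => (isBialternating_listCls_tmul S).splitSum.add_eq_zero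

theorem coproduct_cls (F : OrientedForest S) : coproduct S (cls F) =
    splitSum F.vertices fun L R => listCls S L ⊗ₜ[ℚ] listCls S R :=
  liftBess_cls _ _ F

theorem coproduct_noVertex (hS : S.Nonempty) :
    coproduct S (cls (.noVertex hS)) = cls (.noVertex hS) ⊗ₜ[ℚ] cls (.noVertex hS) := by
  rw [coproduct_cls, ← listCls_vertices]
  rfl

theorem coproduct_graftSum (h : Disjoint S T) (F : OrientedForest S) (G : OrientedForest T) :
    coproduct (S ∪ T) (graftSum h F G) =
      ∑ r ∈ F.trees, ∑ s ∈ G.trees, splitSum ((r, s) :: (F.vertices ++ G.vertices))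
        fun L R => listCls (S ∪ T) L ⊗ₜ[ℚ] listCls (S ∪ T) R := by
  simp only [graftSum, map_sum, coproduct_cls, OrientedForest.graft]
  rw [← Finset.sum_attach F.trees]
  refine Finset.sum_congr rfl fun r _ => ?_
  rw [← Finset.sum_attach G.trees]

theorem compTensor_coproduct_cls (μ ν : Bess S →ₗ[ℚ] Bess T →ₗ[ℚ] Bess (S ∪ T))
    (F : OrientedForest S) (G : OrientedForest T) :
    compTensor μ ν (coproduct S (cls F)) (coproduct T (cls G)) =
      splitSum F.vertices fun L R => splitSum G.vertices fun L' R' =>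
        (-1 : ℚ) ^ (R.length * L'.length) •
          (μ (listCls S L) (listCls T L') ⊗ₜ[ℚ] ν (listCls S R) (listCls T R')) := by
  rw [← compTensorBilin_apply, coproduct_cls, coproduct_cls, map₂_splitSum]
  simp only [compTensorBilin_apply, compTensor_tmul_listCls]

theorem compTensorOdd_coproduct_cls (μ ν : Bess S →ₗ[ℚ] Bess T →ₗ[ℚ] Bess (S ∪ T))
    (F : OrientedForest S) (G : OrientedForest T) :
    compTensorOdd μ ν (coproduct S (cls F)) (coproduct T (cls G)) =
      splitSum F.vertices fun L R => splitSum G.vertices fun L' R' =>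
        (-1 : ℚ) ^ (R.length * L'.length) • (-1 : ℚ) ^ (L.length + L'.length) •
          (μ (listCls S L) (listCls T L') ⊗ₜ[ℚ] ν (listCls S R) (listCls T R')) := by
  rw [compTensorOdd, ← compTensorBilin_apply, coproduct_cls, coproduct_cls, map_splitSum,
    map_splitSum, map₂_splitSum]
  simp only [TensorProduct.map_tmul, parity_listCls, LinearMap.id_apply,
    ← TensorProduct.smul_tmul', map_smul, LinearMap.smul_apply, compTensorBilin_apply,
    compTensor_tmul_listCls, pow_add, smul_smul]
  refine congrArg _ (funext₂ fun L R => congrArg _ (funext₂ fun L' R' => ?_))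
  ring_nf

theorem coproduct_compE (h : Disjoint S T) (x : Bess S) (y : Bess T) :
    coproduct (S ∪ T) (compE h x y) =
      compTensor (compE h) (compE h) (coproduct S x) (coproduct T y) := by
  suffices key : (compE h).compr₂ (coproduct (S ∪ T)) =
      (compTensorBilin (compE h) (compE h)).compl₁₂ (coproduct S) (coproduct T) from
    LinearMap.congr_fun₂ key x y
  refine bilin_ext fun F G => ?_
  rw [LinearMap.compr₂_apply, LinearMap.compl₁₂_apply, compTensorBilin_apply, compE_cls,
    compTensor_coproduct_cls, coproduct_cls, OrientedForest.disjointUnion, splitSum_append]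
  have hS := F.isForest.nonempty
  have hT := G.isForest.nonempty
  refine splitSum_congr F.liesInTree_of_mem_subvertices fun L R hL hR =>
    splitSum_congr G.liesInTree_of_mem_subvertices fun L' R' hL' hR' => ?_
  rw [listCls_append h hS hT (fun v hv => (hL v hv).subset) fun v hv => (hL' v hv).subset,
    listCls_append h hS hT (fun v hv => (hR v hv).subset) fun v hv => (hR' v hv).subset]

theorem sum_prepend_listCls_tmul (h : Disjoint S T) {F : OrientedForest S} {G : OrientedForest T}
    {L R L' R' : List (OrientedVertex α)} (hL : ∀ v ∈ L, F.LiesInTree v)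
    (hR : ∀ v ∈ R, F.LiesInTree v) (hL' : ∀ v ∈ L', G.LiesInTree v)
    (hR' : ∀ v ∈ R', G.LiesInTree v) :
    ∑ r ∈ F.trees, ∑ s ∈ G.trees, ∑ u ∈ subvertices (r, s),
      prepend u (fun L R => listCls (S ∪ T) L ⊗ₜ[ℚ] listCls (S ∪ T) R) (L ++ L') (R ++ R') =
    (-1 : ℚ) ^ (L.length + L'.length) •
        (compE h (listCls S L) (listCls T L') ⊗ₜ[ℚ] compOmega h (listCls S R) (listCls T R')) +
      compOmega h (listCls S L) (listCls T L') ⊗ₜ[ℚ] compE h (listCls S R) (listCls T R') := by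
  have hS := F.isForest.nonempty
  have hT := G.isForest.nonempty
  simp only [prepend_apply, Finset.sum_add_distrib, ← Finset.smul_sum, ← TensorProduct.tmul_sum,
    ← TensorProduct.sum_tmul]
  rw [sum_subvertices_trees_eq_compOmega h hL hL', sum_subvertices_trees_eq_compOmega h hR hR',
    listCls_append h hS hT (fun v hv => (hL v hv).subset) fun v hv => (hL' v hv).subset,
    listCls_append h hS hT (fun v hv => (hR v hv).subset) fun v hv => (hR' v hv).subset,
    List.length_append, add_comm]

theorem coproduct_compOmega (h : Disjoint S T) (x : Bess S) (y : Bess T) :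
    coproduct (S ∪ T) (compOmega h x y) =
      compTensorOdd (compE h) (compOmega h) (coproduct S x) (coproduct T y) +
        compTensor (compOmega h) (compE h) (coproduct S x) (coproduct T y) := by
  suffices key : (compOmega h).compr₂ (coproduct (S ∪ T)) =
      (compTensorBilin (compE h) (compOmega h)).compl₁₂
        (TensorProduct.map (parity S) LinearMap.id ∘ₗ coproduct S)
        (TensorProduct.map (parity T) LinearMap.id ∘ₗ coproduct T) +
      (compTensorBilin (compOmega h) (compE h)).compl₁₂ (coproduct S) (coproduct T) from
    LinearMap.congr_fun₂ key x y
  refine bilin_ext fun F G => ?_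
  calc coproduct (S ∪ T) (compOmega h (cls F) (cls G))
    _ = splitSum (F.vertices ++ G.vertices) (∑ r ∈ F.trees, ∑ s ∈ G.trees,
          ∑ u ∈ subvertices (r, s),
            prepend u fun L R => listCls (S ∪ T) L ⊗ₜ[ℚ] listCls (S ∪ T) R) := by
      rw [compOmega_cls, coproduct_graftSum]
      simp only [splitSum_cons, map_sum]
    _ = compTensorOdd (compE h) (compOmega h) (coproduct S (cls F)) (coproduct T (cls G)) +
          compTensor (compOmega h) (compE h) (coproduct S (cls F)) (coproduct T (cls G)) := by
      rw [compTensorOdd_coproduct_cls, compTensor_coproduct_cls, ← map_add, splitSum_append]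
      refine splitSum_congr F.liesInTree_of_mem_subvertices fun L R hL hR => ?_
      rw [Pi.add_apply, Pi.add_apply, ← map_add]
      refine splitSum_congr G.liesInTree_of_mem_subvertices fun L' R' hL' hR' => ?_
      simp only [Finset.sum_apply, Pi.add_apply, sum_prepend_listCls_tmul h hL hR hL' hR',
        smul_add]

theorem isCoproduct_coproduct : IsCoproduct (coproduct (α := α)) where
  unit _ := coproduct_noVertex _
  compE _ _ := coproduct_compE
  compOmega _ _ := coproduct_compOmega

end Coproduct

section Generation

variable {α : Type*} [DecidableEq α] {S T : Finset α}

/-- A family of subspaces of the spaces `Bess(S)` containing the unit of the Bessel operad and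
closed under the composition with its generators. -/
structure IsCompositionClosed (p : ∀ S : Finset α, Submodule ℚ (Bess S)) : Prop where
  unit : ∀ a, cls (.noVertex (Finset.singleton_nonempty a)) ∈ p {a}
  compE : ∀ {S T : Finset α} (h : Disjoint S T) {x : Bess S} {y : Bess T}, x ∈ p S → y ∈ p T →
    compE h x y ∈ p (S ∪ T)
  compOmega : ∀ {S T : Finset α} (h : Disjoint S T) {x : Bess S} {y : Bess T}, x ∈ p S →
    y ∈ p T → compOmega h x y ∈ p (S ∪ T)

theorem compOmega_cls_of_trees_eq_singleton (h : Disjoint S T) {F : OrientedForest S}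
    {G : OrientedForest T} {r s : Finset α} (hF : F.trees = {r}) (hG : G.trees = {s}) :
    compOmega h (cls F) (cls G) = cls (F.graft h G (hF ▸ Finset.mem_singleton_self r)
      (hG ▸ Finset.mem_singleton_self s)) := by
  have key : compOmega h (cls F) (cls G) =
      listCls (S ∪ T) ((r, s) :: (F.vertices ++ G.vertices)) := by
    rw [compOmega_cls, graftSum_eq_sum_listCls, hF, hG, Finset.sum_singleton, Finset.sum_singleton]
  exact key.trans (listCls_vertices (F.graft h G _ _))

namespace IsCompositionClosed

variable {p : ∀ S : Finset α, Submodule ℚ (Bess S)}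

theorem exists_cls_mem_of_isTree (hp : IsCompositionClosed p) {V : Finset (Sym2 (Finset α))}
    (hV : IsTree S V) : ∃ F : OrientedForest S, F.vertexSet = V ∧ cls F ∈ p S := by
  induction hV with
  | leaf a => exact ⟨.noVertex (Finset.singleton_nonempty a), rfl, hp.unit a⟩
  | graft hV hW h ihV ihW =>
    obtain ⟨F, rfl, hF⟩ := ihV
    obtain ⟨G, rfl, hG⟩ := ihW
    refine ⟨_, ?_, compOmega_cls_of_trees_eq_singleton h hV.roots_eq hW.roots_eq ▸
      hp.compOmega h hF hG⟩
    simp [OrientedForest.vertexSet, OrientedForest.graft]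

theorem exists_cls_mem_of_isForest (hp : IsCompositionClosed p) {V : Finset (Sym2 (Finset α))}
    (hV : IsForest S V) : ∃ F : OrientedForest S, F.vertexSet = V ∧ cls F ∈ p S := by
  induction hV with
  | tree hV => exact hp.exists_cls_mem_of_isTree hV
  | union hV hW h ihV ihW =>
    obtain ⟨F, rfl, hF⟩ := ihV
    obtain ⟨G, rfl, hG⟩ := ihW
    refine ⟨F.disjointUnion h G, ?_, compE_cls h F G ▸ hp.compE h hF hG⟩
    simp [OrientedForest.vertexSet, OrientedForest.disjointUnion]

theorem cls_mem (hp : IsCompositionClosed p) (F : OrientedForest S) : cls F ∈ p S := by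
  obtain ⟨G, hG, hGp⟩ := hp.exists_cls_mem_of_isForest F.isForest
  obtain ⟨ε, hε⟩ := exists_cls_eq_smul_cls hG.symm
  rw [hε]
  rcases Int.units_eq_one_or ε with rfl | rfl
  · simpa using hGp
  · simpa using hGp

end IsCompositionClosed

theorem family_ext {M : Finset α → Type*} [∀ S, AddCommGroup (M S)] [∀ S, Module ℚ (M S)]
    {f g : ∀ S : Finset α, Bess S →ₗ[ℚ] M S}
    (unit : ∀ a, f {a} (cls (.noVertex (Finset.singleton_nonempty a))) =
      g {a} (cls (.noVertex (Finset.singleton_nonempty a))))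
    (compE_eq : ∀ (S T : Finset α) (h : Disjoint S T) (x : Bess S) (y : Bess T),
      f S x = g S x → f T y = g T y → f (S ∪ T) (compE h x y) = g (S ∪ T) (compE h x y))
    (compOmega_eq : ∀ (S T : Finset α) (h : Disjoint S T) (x : Bess S) (y : Bess T),
      f S x = g S x → f T y = g T y →
        f (S ∪ T) (compOmega h x y) = g (S ∪ T) (compOmega h x y)) : f = g := by
  have closed : IsCompositionClosed fun S => LinearMap.eqLocus (f S) (g S) :=
    ⟨unit, fun h _ _ => compE_eq _ _ h _ _, fun h _ _ => compOmega_eq _ _ h _ _⟩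
  exact funext fun _ => hom_ext fun F => closed.cls_mem F

theorem IsCoproduct.unique {Δ Δ' : ∀ S : Finset α, Bess S →ₗ[ℚ] Bess S ⊗[ℚ] Bess S}
    (h : IsCoproduct Δ) (h' : IsCoproduct Δ') : Δ = Δ' :=
  family_ext (M := fun S => Bess S ⊗[ℚ] Bess S) (fun a => (h.unit a).trans (h'.unit a).symm)
    (fun _ _ _ _ _ hx hy => by rw [h.compE, h'.compE, hx, hy])
    (fun _ _ _ _ _ hx hy => by rw [h.compOmega, h'.compOmega, hx, hy])

end Generation

section Counit

variable {α : Type*} [DecidableEq α] {S T : Finset α}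

/-- The counit of `Bess(S)`: the coefficient of the forest with no inner vertex. -/
noncomputable def counit (S : Finset α) : Bess S →ₗ[ℚ] ℚ :=
  liftBess (fun F => if F.vertices = [] then 1 else 0) fun F G h => by
    cases h with
    | swap l₁ l₂ v w hF hG => simp [hF, hG]
    | flip l₁ l₂ A B hF hG => simp [hF, hG]

theorem counit_cls (F : OrientedForest S) :
    counit S (cls F) = if F.vertices = [] then 1 else 0 :=
  liftBess_cls _ _ F

theorem counit_noVertex (hS : S.Nonempty) : counit S (cls (.noVertex hS)) = 1 :=
  (counit_cls _).trans (if_pos rfl)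

theorem counit_parity (x : Bess S) : counit S (parity S x) = counit S x := by
  suffices h : counit S ∘ₗ parity S = counit S from LinearMap.congr_fun h x
  refine hom_ext fun F => ?_
  rw [LinearMap.comp_apply, parity_cls, map_smul, counit_cls]
  split_ifs with hF <;> simp [hF]

theorem counit_compE (h : Disjoint S T) (x : Bess S) (y : Bess T) :
    counit (S ∪ T) (compE h x y) = counit S x * counit T y := by
  suffices key : (compE h).compr₂ (counit (S ∪ T)) =
      (LinearMap.mul ℚ ℚ).compl₁₂ (counit S) (counit T) from LinearMap.congr_fun₂ key x y
  refine bilin_ext fun F G => ?_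
  rw [LinearMap.compr₂_apply, LinearMap.compl₁₂_apply, LinearMap.mul_apply', compE_cls,
    counit_cls, counit_cls, counit_cls, ite_zero_mul_ite_zero, mul_one]
  simp only [OrientedForest.disjointUnion, List.append_eq_nil_iff]

theorem counit_compOmega (h : Disjoint S T) (x : Bess S) (y : Bess T) :
    counit (S ∪ T) (compOmega h x y) = 0 := by
  suffices key : (compOmega h).compr₂ (counit (S ∪ T)) = 0 from LinearMap.congr_fun₂ key x y
  refine bilin_ext fun F G => ?_
  simp [compOmega_cls, graftSum, counit_cls, OrientedForest.graft]

/-- The map `x₁ ⊗ x₂ ↦ ε(x₁) x₂`. -/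
noncomputable def counitLeft (S : Finset α) : Bess S ⊗[ℚ] Bess S →ₗ[ℚ] Bess S :=
  (TensorProduct.lid ℚ (Bess S)).toLinearMap ∘ₗ (counit S).rTensor (Bess S)

/-- The map `x₁ ⊗ x₂ ↦ ε(x₂) x₁`. -/
noncomputable def counitRight (S : Finset α) : Bess S ⊗[ℚ] Bess S →ₗ[ℚ] Bess S :=
  (TensorProduct.rid ℚ (Bess S)).toLinearMap ∘ₗ (counit S).lTensor (Bess S)

@[simp] theorem counitLeft_tmul (x y : Bess S) : counitLeft S (x ⊗ₜ[ℚ] y) = counit S x • y := by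
  simp [counitLeft]

@[simp] theorem counitRight_tmul (x y : Bess S) :
    counitRight S (x ⊗ₜ[ℚ] y) = counit S y • x := by
  simp [counitRight]

theorem tensor_bilin_ext {M : Type*} [AddCommGroup M] [Module ℚ M]
    {f g : Bess S ⊗[ℚ] Bess S →ₗ[ℚ] Bess T ⊗[ℚ] Bess T →ₗ[ℚ] M}
    (h : ∀ x F G y, f (x ⊗ₜ[ℚ] cls F) (cls G ⊗ₜ[ℚ] y) = g (x ⊗ₜ[ℚ] cls F) (cls G ⊗ₜ[ℚ] y)) :
    f = g :=
  TensorProduct.ext <| LinearMap.ext fun x => hom_ext fun F => TensorProduct.ext <|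
    hom_ext fun G => LinearMap.ext fun y => h x F G y

-- The Koszul sign is trivial where `ε` does not vanish.
theorem neg_one_pow_mul_counit_cls (n : ℕ) (F : OrientedForest S) :
    (-1 : ℚ) ^ (n * F.vertices.length) * counit S (cls F) = counit S (cls F) := by
  rw [counit_cls]
  split_ifs with hF <;> simp [hF]

theorem counitLeft_compTensor {μ ν : Bess S →ₗ[ℚ] Bess T →ₗ[ℚ] Bess (S ∪ T)} {c : ℚ}
    (hμ : ∀ x y, counit (S ∪ T) (μ x y) = c * (counit S x * counit T y))
    (X : Bess S ⊗[ℚ] Bess S) (Y : Bess T ⊗[ℚ] Bess T) :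
    counitLeft (S ∪ T) (compTensor μ ν X Y) = c • ν (counitLeft S X) (counitLeft T Y) := by
  suffices key : (compTensorBilin μ ν).compr₂ (counitLeft (S ∪ T)) =
      c • ν.compl₁₂ (counitLeft S) (counitLeft T) from LinearMap.congr_fun₂ key X Y
  refine tensor_bilin_ext fun x F G y => ?_
  simp only [LinearMap.compr₂_apply, LinearMap.smul_apply, LinearMap.compl₁₂_apply,
    compTensorBilin_apply, compTensor_tmul_cls, map_smul,
    counitLeft_tmul, hμ, smul_smul]
  congr 1
  linear_combination c * counit S x * neg_one_pow_mul_counit_cls F.vertices.length G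

theorem counitRight_compTensor {μ ν : Bess S →ₗ[ℚ] Bess T →ₗ[ℚ] Bess (S ∪ T)} {c : ℚ}
    (hν : ∀ x y, counit (S ∪ T) (ν x y) = c * (counit S x * counit T y))
    (X : Bess S ⊗[ℚ] Bess S) (Y : Bess T ⊗[ℚ] Bess T) :
    counitRight (S ∪ T) (compTensor μ ν X Y) = c • μ (counitRight S X) (counitRight T Y) := by
  suffices key : (compTensorBilin μ ν).compr₂ (counitRight (S ∪ T)) =
      c • μ.compl₁₂ (counitRight S) (counitRight T) from LinearMap.congr_fun₂ key X Y
  refine tensor_bilin_ext fun x F G y => ?_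
  simp only [LinearMap.compr₂_apply, LinearMap.smul_apply, LinearMap.compl₁₂_apply,
    compTensorBilin_apply, compTensor_tmul_cls, map_smul,
    counitRight_tmul, hν, smul_smul]
  congr 1
  linear_combination c * counit T y * neg_one_pow_mul_counit_cls G.vertices.length F

theorem counitLeft_map_parity (X : Bess S ⊗[ℚ] Bess S) :
    counitLeft S (TensorProduct.map (parity S) LinearMap.id X) = counitLeft S X := by
  suffices h : counitLeft S ∘ₗ TensorProduct.map (parity S) LinearMap.id = counitLeft S from
    LinearMap.congr_fun h X
  exact TensorProduct.ext' fun x y => by simp [counit_parity]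

namespace IsCoproduct

variable {Δ : ∀ S : Finset α, Bess S →ₗ[ℚ] Bess S ⊗[ℚ] Bess S}

theorem counitLeft_comp (hΔ : IsCoproduct Δ) (S : Finset α) :
    counitLeft S ∘ₗ Δ S = LinearMap.id := by
  suffices h : (fun S => counitLeft S ∘ₗ Δ S) = fun _ => LinearMap.id from congrFun h S
  refine family_ext (fun a => ?_) (fun S T h x y hx hy => ?_) fun S T h x y hx hy => ?_
  · rw [LinearMap.comp_apply, hΔ.unit, counitLeft_tmul, counit_noVertex, one_smul,
      LinearMap.id_apply]
  all_goals simp only [LinearMap.comp_apply, LinearMap.id_apply] at hx hy ⊢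
  · rw [hΔ.compE, counitLeft_compTensor (c := 1) (by simp [counit_compE]), hx, hy, one_smul]
  · rw [hΔ.compOmega, map_add, compTensorOdd,
      counitLeft_compTensor (c := 1) (by simp [counit_compE]),
      counitLeft_compTensor (c := 0) (by simp [counit_compOmega]), counitLeft_map_parity,
      counitLeft_map_parity, hx, hy, one_smul, zero_smul, add_zero]

theorem counitRight_comp (hΔ : IsCoproduct Δ) (S : Finset α) :
    counitRight S ∘ₗ Δ S = LinearMap.id := by
  suffices h : (fun S => counitRight S ∘ₗ Δ S) = fun _ => LinearMap.id from congrFun h S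
  refine family_ext (fun a => ?_) (fun S T h x y hx hy => ?_) fun S T h x y hx hy => ?_
  · rw [LinearMap.comp_apply, hΔ.unit, counitRight_tmul, counit_noVertex, one_smul,
      LinearMap.id_apply]
  all_goals simp only [LinearMap.comp_apply, LinearMap.id_apply] at hx hy ⊢
  · rw [hΔ.compE, counitRight_compTensor (c := 1) (by simp [counit_compE]), hx, hy, one_smul]
  · rw [hΔ.compOmega, map_add, compTensorOdd,
      counitRight_compTensor (c := 0) (by simp [counit_compOmega]),
      counitRight_compTensor (c := 1) (by simp [counit_compE]), hx, hy, one_smul, zero_smul,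
      zero_add]

theorem counit_rTensor (hΔ : IsCoproduct Δ) (S : Finset α) :
    (counit S).rTensor (Bess S) ∘ₗ Δ S = TensorProduct.mk ℚ ℚ (Bess S) 1 :=
  LinearMap.ext fun x => (TensorProduct.lid ℚ (Bess S)).injective <| by
    simpa [counitLeft] using LinearMap.congr_fun (hΔ.counitLeft_comp S) x

theorem counit_lTensor (hΔ : IsCoproduct Δ) (S : Finset α) :
    (counit S).lTensor (Bess S) ∘ₗ Δ S = (TensorProduct.mk ℚ (Bess S) ℚ).flip 1 :=
  LinearMap.ext fun x => (TensorProduct.rid ℚ (Bess S)).injective <| by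
    simpa [counitRight] using LinearMap.congr_fun (hΔ.counitRight_comp S) x

end IsCoproduct

theorem counit_smul_noVertex (hS : S.Nonempty) {x : Bess S} (hx : x ∈ component S 0) :
    counit S x • cls (.noVertex hS) = x := by
  suffices h : Set.EqOn (LinearMap.toSpanSingleton ℚ (Bess S) (cls (.noVertex hS)) ∘ₗ counit S)
      (LinearMap.id : Bess S →ₗ[ℚ] Bess S) (component S 0) from h hx
  refine LinearMap.eqOn_span' ?_
  rintro _ ⟨F, hF, rfl⟩
  obtain rfl : F = .noVertex hS := OrientedForest.ext (List.length_eq_zero_iff.1 hF)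
  simp [counit_noVertex]

/-- The identification of the component of degree zero with `ℚ`. -/
noncomputable def componentZeroEquiv (hS : S.Nonempty) : component S 0 ≃ₗ[ℚ] ℚ :=
  LinearEquiv.ofLinearMap (counit S ∘ₗ (component S 0).subtype)
    (LinearMap.toSpanSingleton ℚ _ (unitForest S hS))
    (LinearMap.ext_ring <| by
      rw [LinearMap.comp_apply, LinearMap.toSpanSingleton_apply, one_smul]
      exact counit_noVertex hS)
    (LinearMap.ext fun x => Subtype.ext (counit_smul_noVertex hS x.2))

theorem componentZeroEquiv_comp_proj (hS : S.Nonempty) :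
    (componentZeroEquiv hS).toLinearMap ∘ₗ proj S 0 = counit S := by
  refine hom_ext fun F => ?_
  suffices h : counit S (projEnd S 0 (cls F)) = counit S (cls F) from h
  simp only [projEnd_cls, List.length_eq_zero_iff, apply_ite (counit S), map_zero, counit_cls]
  split_ifs <;> rfl

end Counit

end Bessel

theorem mainTheorem7 {α : Type*} [DecidableEq α] :
    ∃ Δ : ∀ S : Finset α, Bessel.Bess S →ₗ[ℚ] Bessel.Bess S ⊗[ℚ] Bessel.Bess S,
      Bessel.IsCoproduct Δ ∧ (∀ Δ₁, Bessel.IsCoproduct Δ₁ → Δ₁ = Δ) ∧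
      ∀ (S : Finset α) (hS : S.Nonempty),
        Module.finrank ℚ (Bessel.component S 0) = 1 ∧
        ∃ e : Bessel.component S 0 ≃ₗ[ℚ] ℚ,
          e (Bessel.unitForest S hS) = 1 ∧
          ∃ (ε : Bessel.Bess S →ₗ[ℚ] ℚ) (η : ℚ →ₗ[ℚ] Bessel.Bess S),
            ε = e.toLinearMap ∘ₗ Bessel.proj S 0 ∧
            η = (Bessel.component S 0).subtype ∘ₗ e.symm.toLinearMap ∧
            -- `ε` is a counit
            ε.rTensor (Bessel.Bess S) ∘ₗ Δ S = TensorProduct.mk ℚ ℚ (Bessel.Bess S) 1 ∧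
            ε.lTensor (Bessel.Bess S) ∘ₗ Δ S = (TensorProduct.mk ℚ (Bessel.Bess S) ℚ).flip 1 ∧
            -- `η` is an augmentation: a morphism of coalgebras, compatible with the counits
            Δ S ∘ₗ η = TensorProduct.map η η ∘ₗ (CoalgebraStruct.comul : ℚ →ₗ[ℚ] ℚ ⊗[ℚ] ℚ) ∧
            ε ∘ₗ η = (CoalgebraStruct.counit : ℚ →ₗ[ℚ] ℚ) ∧
            -- the forest with no inner vertex is grouplike
            Δ S (Bessel.unitForest S hS) =
              (Bessel.unitForest S hS : Bessel.Bess S) ⊗ₜ[ℚ]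
                (Bessel.unitForest S hS : Bessel.Bess S) ∧
            ε (Bessel.unitForest S hS) = 1 := by
  refine ⟨Bessel.coproduct, Bessel.isCoproduct_coproduct,
    fun Δ₁ h => h.unique Bessel.isCoproduct_coproduct, fun S hS => ?_⟩
  have hsymm : (Bessel.componentZeroEquiv hS).symm 1 = Bessel.unitForest S hS :=
    one_smul ℚ (Bessel.unitForest S hS)
  have hunit : Bessel.componentZeroEquiv hS (Bessel.unitForest S hS) = 1 :=
    Bessel.counit_noVertex hS
  refine ⟨?_, Bessel.componentZeroEquiv hS, hunit, _, _, rfl, rfl, ?_⟩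
  · rw [(Bessel.componentZeroEquiv hS).finrank_eq, Module.finrank_self]
  rw [Bessel.componentZeroEquiv_comp_proj]
  refine ⟨Bessel.isCoproduct_coproduct.counit_rTensor S,
    Bessel.isCoproduct_coproduct.counit_lTensor S, LinearMap.ext_ring ?_, LinearMap.ext_ring ?_,
    Bessel.coproduct_noVertex hS, Bessel.counit_noVertex hS⟩
  · simp only [LinearMap.comp_apply, LinearEquiv.coe_coe, hsymm, CommSemiring.comul_apply,
      TensorProduct.map_tmul]
    exact Bessel.coproduct_noVertex hS
  · simp only [LinearMap.comp_apply, LinearEquiv.coe_coe, hsymm, CommSemiring.counit_apply]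
    exact Bessel.counit_noVertex hS
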